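/- **Setting.** Let $X,\eta$ be independent nonnegative random variables with probability densities $f$ (unknown) and $g$ (known), both supported on $[0,\infty)$, and let $Y_1,\dots,Y_n$ be i.i.d. copies of $Y=X\eta$. Let $\widetilde g(z)=\int_0^\infty x^{z-1}g(x)\,dx$ be the Mellin transform of $g$. For an estimator $\hat f(x_0)$ based on $Y_1,\dots,Y_n$ and a class $\Sigma$ of densities of $X$ put $$\mathcal R_n[\hat f;\Sigma]=\sup_{f\in\Sigma}\big(\mathbb E_f|\hat f(x_0)-f(x_0)|^2\big)^{1/2}.$$ **Class.** For $\beta>0$, $A>0$, $x_0>0$, $r>1$ let $\ell=\lfloor\beta\rfloor:=\max\{k\in\mathbb N_0:k<\beta\}$, and let $\mathscr H_{x_0,r}(A,\beta)$ be the set of probability densities $f$ on $[0,\infty)$ that are $\ell$ times continuously differentiable on $I=[r^{-1}x_0,rx_0]$ with $|f^{(k)}(x)|\le A$ for $x\in I$, $1\le k\le\ell$, and $|f^{(\ell)}(x)-f^{(\ell)}(x')|\le A|x-x'|^{\beta-\ell}$ for $x,x'\in I$. **Super-smooth errors ([G2] at $\sigma=1$, with rate $\gamma>0$).** There are constants $c_0>0$,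 $\omega_0>0$, $\nu\in\mathbb R$, $B_2\ge B_1>0$ such that $|\widetilde g(1+i\omega)|\ge c_0$ for $|\omega|\le\omega_0$ and $$B_1|\omega|^{\nu}e^{-\gamma|\omega|}\le|\widetilde g(1+i\omega)|\le B_2|\omega|^{\nu}e^{-\gamma|\omega|}\quad\text{for }|\omega|\ge\omega_0 .$$ **Estimator.** Let $\lambda\ge2$ be a natural number, let $w$ be the function with Fourier transform $\widehat w(\omega)=\int w(t)e^{-i\omega t}dt=\exp\{-|\omega|^{2\lambda}/(2\lambda)\}$, and for a positive integer $m$ let $K(t)=\sum_{j=1}^{m+1}\binom{m+1}{j}(-1)^{j+1}\frac1j\,w(t/j)$. For $h>0$ put $$L_h(x,y)=\frac1{2\pi x}\int_{-\infty}^\infty\Big|\frac xy\Big|^{i\omega}\frac{\widehat K(\omega h)}{\widetilde g(1-i\omega)}\,d\omega\ \ (y/x>0),\qquad L_h(x,y)=0\ \text{ otherwise},\qquad \hat f_h(x_0)=\frac1n\sum_{j=1}^nL_h(x_0,Y_j).$$ **Theorem.** For every natural number $\lambda\ge2$ there is a constant $c>0$ depending only on $\lambda$ such that for every $C_1\ge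 c$, every $\beta>0$ and every integer $m\ge\lfloor\beta\rfloor+1$ there is a finite constant $C_2>0$, depending only on $\lambda,C_1,\beta,m$, with the following property. Let $g$ be a probability density on $[0,\infty)$ satisfying [G2] at $\sigma=1$ with rate $\gamma$, and let $x_0>0$, $r>1$, $A>0$. Then the integral defining $L_h(x_0,y)$ converges absolutely for all $h>0$, $y>0$, and with $$h_*=C_1\gamma\big[\ln(A^2x_0^{2\beta+2}n)\big]^{-1+\frac1{2\lambda}},\qquad \varphi_n=A\gamma^\beta(\ln n)^{-\beta(1-\frac1{2\lambda})}x_0^\beta$$ one has $$\limsup_{n\to\infty}\Big\{\varphi_n^{-1}\,\mathcal R_n\big[\hat f_{h_*};\mathscr H_{x_0,r}(A,\beta)\big]\Big\}\le C_2 .$$ -/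

import Mathlib

open MeasureTheory Filter
open scoped ENNReal FourierTransform

namespace MultDeconv

noncomputable section

/-- A (Borel) probability density on the real line which is supported on `[0, ∞)`. -/
structure IsDensityOnNonneg (f : ℝ → ℝ) : Prop where
  measurable : Measurable f
  nonneg : ∀ x, 0 ≤ f x
  lintegral_eq_one : ∫⁻ x, ENNReal.ofReal (f x) = 1
  support_nonneg : ∀ x, x < 0 → f x = 0

/-- `⌊β⌋ := max {k ∈ ℕ₀ : k < β}`, the largest nonnegative integer *strictly* below `β > 0`. -/
def strictFloor (β : ℝ) : ℕ := ⌈β⌉₊ - 1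

theorem isGreatest_strictFloor {β : ℝ} (hβ : 0 < β) :
    IsGreatest {k : ℕ | (k : ℝ) < β} (strictFloor β) := by
  have h1 : 0 < ⌈β⌉₊ := Nat.ceil_pos.mpr hβ
  constructor
  · change ((⌈β⌉₊ - 1 : ℕ) : ℝ) < β
    exact Nat.lt_ceil.mp (by omega)
  · intro k hk
    have h2 : k < ⌈β⌉₊ := Nat.lt_ceil.mpr hk
    change k ≤ ⌈β⌉₊ - 1
    omega

/-- The local Hölder class `H_{x₀,r}(A, β)` of probability densities (of nonnegative random
variables): with `ℓ = strictFloor β`, the density is `ℓ` times continuously differentiable on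
`[x₀ / r, r x₀]`, its derivatives of orders `1, …, ℓ` are bounded there by `A`, and its `ℓ`-th
derivative is Hölder there, with exponent `β - ℓ` and constant `A`. -/
structure HolderClass (x₀ r A β : ℝ) (f : ℝ → ℝ) : Prop where
  density : IsDensityOnNonneg f
  contDiffOn : ContDiffOn ℝ (strictFloor β) f (Set.Icc (x₀ / r) (r * x₀))
  deriv_le : ∀ k : ℕ, 1 ≤ k → k ≤ strictFloor β → ∀ x ∈ Set.Icc (x₀ / r) (r * x₀),
    |iteratedDerivWithin k f (Set.Icc (x₀ / r) (r * x₀)) x| ≤ A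
  holder : ∀ x ∈ Set.Icc (x₀ / r) (r * x₀), ∀ x' ∈ Set.Icc (x₀ / r) (r * x₀),
    |iteratedDerivWithin (strictFloor β) f (Set.Icc (x₀ / r) (r * x₀)) x
        - iteratedDerivWithin (strictFloor β) f (Set.Icc (x₀ / r) (r * x₀)) x'|
      ≤ A * |x - x'| ^ (β - (strictFloor β : ℝ))

/-- The Mellin transform `∫₀^∞ x^(z-1) g(x) dx` of a real function. -/
def mellinR (g : ℝ → ℝ) (z : ℂ) : ℂ := mellin (fun x => (g x : ℂ)) z

/-- The super-smoothness assumption on the line `Re z = σ` with exponential rate `γ`. -/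
def SuperSmooth (g : ℝ → ℝ) (σ γ : ℝ) : Prop :=
  0 < γ ∧ ∃ c₀ ω₀ ν B₁ B₂ : ℝ, 0 < c₀ ∧ 0 < ω₀ ∧ 0 < B₁ ∧ B₁ ≤ B₂ ∧
    (∀ ω : ℝ, |ω| ≤ ω₀ → c₀ ≤ ‖mellinR g (σ + ω * Complex.I)‖) ∧
    (∀ ω : ℝ, ω₀ ≤ |ω| →
      B₁ * |ω| ^ ν * Real.exp (-γ * |ω|) ≤ ‖mellinR g (σ + ω * Complex.I)‖ ∧
      ‖mellinR g (σ + ω * Complex.I)‖ ≤ B₂ * |ω| ^ ν * Real.exp (-γ * |ω|))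

/-- The bilateral Laplace transform `∫ u(t) e^(-zt) dt`; its value at `iω` is the Fourier
transform of `u` at `ω`. -/
def bilateralLaplace (u : ℝ → ℝ) (z : ℂ) : ℂ := ∫ t : ℝ, (u t : ℂ) * Complex.exp (-z * t)

/-- The function `exp(-|ω|^(2λ) / (2λ))`. -/
def wHat (lam : ℕ) (ω : ℝ) : ℝ := Real.exp (-(|ω| ^ (2 * lam)) / (2 * lam))

/-- The function `w` whose Fourier transform is `wHat` (see `fourier_w`), given by Fourier
inversion of the even function `wHat`. -/
def w (lam : ℕ) (t : ℝ) : ℝ := (2 * Real.pi)⁻¹ * ∫ ω : ℝ, wHat lam ω * Real.cos (ω * t)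

theorem wHat_eq (lam : ℕ) (ω : ℝ) : wHat lam ω = Real.exp (-(ω ^ (2 * lam)) / (2 * lam)) := by
  simp [wHat, pow_mul]

theorem integrable_pow_mul_wHat {lam : ℕ} (hlam : 1 ≤ lam) (k : ℕ) :
    Integrable fun ω : ℝ => ω ^ k * wHat lam ω := by
  have hl : (0 : ℝ) < 2 * lam := by positivity
  have hG : Integrable fun ω : ℝ => |ω| ^ k * Real.exp (-(1 / (2 * lam)) * ω ^ 2) := by
    have h := (integrable_rpow_mul_exp_neg_mul_sq (b := 1 / (2 * (lam : ℝ))) (by positivity)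
      (s := (k : ℝ)) (by have := Nat.cast_nonneg (α := ℝ) k; linarith)).norm
    refine h.congr (Eventually.of_forall fun ω => ?_)
    simp [Real.rpow_natCast]
  refine (hG.const_mul (Real.exp (1 / (2 * lam)))).mono' ?_ (Eventually.of_forall fun ω => ?_)
  · simp only [wHat_eq]
    fun_prop
  · have h1 : ω ^ 2 ≤ 1 + ω ^ (2 * lam) := by
      rw [pow_mul]
      rcases le_total (ω ^ 2) 1 with h | h
      · have : 0 ≤ (ω ^ 2) ^ lam := by positivity
        linarith
      · have := le_self_pow₀ h (show lam ≠ 0 by omega)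
        linarith
    have h2 : wHat lam ω ≤ Real.exp (1 / (2 * lam)) * Real.exp (-(1 / (2 * lam)) * ω ^ 2) := by
      rw [wHat_eq, ← Real.exp_add]
      apply Real.exp_le_exp.mpr
      rw [div_le_iff₀ hl]
      field_simp
      linarith
    rw [norm_mul, norm_pow, Real.norm_eq_abs, Real.norm_of_nonneg (by rw [wHat]; positivity)]
    calc |ω| ^ k * wHat lam ω ≤ |ω| ^ k * (Real.exp (1 / (2 * lam)) * Real.exp (-(1 / (2 * lam)) * ω ^ 2)) := by
          gcongr
      _ = Real.exp (1 / (2 * lam)) * (|ω| ^ k * Real.exp (-(1 / (2 * lam)) * ω ^ 2)) := by ring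

theorem hasDerivAt_wHat {lam : ℕ} (hlam : 1 ≤ lam) (ω : ℝ) :
    HasDerivAt (wHat lam) (-(ω ^ (2 * lam - 1) * wHat lam ω)) ω := by
  have e : wHat lam = fun ω => Real.exp (-(ω ^ (2 * lam)) / (2 * lam)) := funext (wHat_eq lam)
  rw [e]
  have hl : (0 : ℝ) < 2 * lam := by positivity
  have := (((hasDerivAt_pow (2 * lam) ω).neg).div_const (2 * (lam : ℝ))).exp
  convert! this using 1
  simp only [Pi.neg_apply]
  push_cast
  field_simp

theorem integrable_fourier_wHat {lam : ℕ} (hlam : 1 ≤ lam) :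
    Integrable (𝓕 fun ω : ℝ => (wHat lam ω : ℂ)) := by
  have hint : ∀ k : ℕ, Integrable fun ω : ℝ => ((ω ^ k * wHat lam ω : ℝ) : ℂ) :=
    fun k => (integrable_pow_mul_wHat hlam k).ofReal
  set φ : ℝ → ℂ := fun ω => (wHat lam ω : ℂ) with hφ
  have hφ0 : Integrable φ := by simpa using hint 0
  have d1 : ∀ ω, HasDerivAt φ (((-(ω ^ (2 * lam - 1) * wHat lam ω) : ℝ)) : ℂ) ω :=
    fun ω => (hasDerivAt_wHat hlam ω).ofReal_comp
  have e1 : deriv φ = fun ω => (((-(ω ^ (2 * lam - 1) * wHat lam ω) : ℝ)) : ℂ) :=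
    funext fun ω => (d1 ω).deriv
  have i1 : Integrable (deriv φ) := by
    rw [e1]
    simpa using (hint (2 * lam - 1)).neg
  have d2 : ∀ ω, HasDerivAt (deriv φ)
      (((-((2 * lam - 1 : ℕ) * ω ^ (2 * lam - 1 - 1) * wHat lam ω
        + ω ^ (2 * lam - 1) * (-(ω ^ (2 * lam - 1) * wHat lam ω))) : ℝ)) : ℂ) ω := by
    intro ω
    rw [e1]
    exact (((hasDerivAt_pow (2 * lam - 1) ω).mul (hasDerivAt_wHat hlam ω)).neg).ofReal_comp
  have i2 : Integrable (deriv (deriv φ)) := by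
    have : deriv (deriv φ) = fun ω => (((-((2 * lam - 1 : ℕ) * ω ^ (2 * lam - 1 - 1) * wHat lam ω
        + ω ^ (2 * lam - 1) * (-(ω ^ (2 * lam - 1) * wHat lam ω))) : ℝ)) : ℂ) :=
      funext fun ω => (d2 ω).deriv
    rw [this]
    have := ((integrable_pow_mul_wHat hlam (2 * lam - 1 + (2 * lam - 1))).sub
      ((integrable_pow_mul_wHat hlam (2 * lam - 1 - 1)).const_mul ((2 * lam - 1 : ℕ) : ℝ))).ofReal
        (𝕜 := ℂ)
    refine this.congr (Eventually.of_forall fun ω => ?_)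
    simp only [Pi.sub_apply, pow_add]
    generalize 2 * lam - 1 = k
    change Complex.ofReal _ = Complex.ofReal _
    rw [Complex.ofReal_inj]
    ring_nf
    rfl
  have f1 := Real.fourier_deriv hφ0 (fun ω => (d1 ω).differentiableAt) i1
  have f2 := Real.fourier_deriv i1 (fun ω => (d2 ω).differentiableAt) i2
  have bd : ∀ (ψ : ℝ → ℂ) (x : ℝ), ‖𝓕 ψ x‖ ≤ ∫ v, ‖ψ v‖ := fun ψ x =>
    VectorFourier.norm_fourierIntegral_le_integral_norm _ _ _ _ _
  have hcont : Continuous (𝓕 φ) :=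
    VectorFourier.fourierIntegral_continuous Real.continuous_fourierChar
      (by fun_prop) hφ0
  refine (integrable_inv_one_add_sq.const_mul
    ((∫ v, ‖φ v‖) + ∫ v, ‖deriv (deriv φ) v‖)).mono' hcont.aestronglyMeasurable
    (Eventually.of_forall fun x => ?_)
  have b0 := bd φ x
  have b2 := bd (deriv (deriv φ)) x
  rw [f2] at b2
  simp only [f1, smul_eq_mul, norm_mul, Complex.norm_real, Complex.norm_I, Complex.norm_ofNat,
    Real.norm_eq_abs, abs_of_pos Real.pi_pos] at b2
  have hpi : (1 : ℝ) ≤ 2 * Real.pi := by linarith [Real.pi_gt_three]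
  have b3 : x ^ 2 * ‖𝓕 φ x‖ ≤ ∫ v, ‖deriv (deriv φ) v‖ := by
    refine le_trans ?_ b2
    have : x ^ 2 = |x| * |x| := by rw [← sq, sq_abs]
    have h4 : (1 : ℝ) ≤ (2 * Real.pi) * (2 * Real.pi) := by nlinarith
    have h5 : 0 ≤ x ^ 2 * ‖𝓕 φ x‖ := by positivity
    calc x ^ 2 * ‖𝓕 φ x‖ ≤ (2 * Real.pi) * (2 * Real.pi) * (x ^ 2 * ‖𝓕 φ x‖) := by nlinarith
      _ = _ := by rw [this]; ring
  rw [← div_eq_mul_inv, le_div_iff₀ (by positivity)]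
  linarith

theorem w_eq_fourier {lam : ℕ} (hlam : 1 ≤ lam) (t : ℝ) :
    (w lam t : ℂ) = ((2 * Real.pi)⁻¹ : ℝ) • 𝓕 (fun ω : ℝ => (wHat lam ω : ℂ)) (t / (2 * Real.pi)) := by
  have h0 : Integrable fun ω : ℝ => wHat lam ω := by simpa using integrable_pow_mul_wHat hlam 0
  have hc : Integrable fun ω : ℝ => wHat lam ω * Real.cos (ω * t) :=
    h0.mul_bdd (c := 1) (by fun_prop)
      (Eventually.of_forall fun ω => by simpa using Real.abs_cos_le_one _)
  have hs : Integrable fun ω : ℝ => wHat lam ω * Real.sin (ω * t) :=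
    h0.mul_bdd (c := 1) (by fun_prop)
      (Eventually.of_forall fun ω => by simpa using Real.abs_sin_le_one _)
  have hs0 : ∫ ω : ℝ, wHat lam ω * Real.sin (ω * t) = 0 := by
    have := integral_neg_eq_self (fun ω : ℝ => wHat lam ω * Real.sin (ω * t)) volume
    simp only [neg_mul, Real.sin_neg, mul_neg, integral_neg] at this
    have h' : ∀ ω, wHat lam (-ω) = wHat lam ω := fun ω => by simp [wHat]
    simp only [h'] at this
    linarith
  have e : ∀ ω : ℝ, Complex.exp (↑(-2 * Real.pi * ω * (t / (2 * Real.pi))) * Complex.I)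
      • (wHat lam ω : ℂ) = ((wHat lam ω * Real.cos (ω * t) : ℝ) : ℂ)
        - ((wHat lam ω * Real.sin (ω * t) : ℝ) : ℂ) * Complex.I := by
    intro ω
    have : -2 * Real.pi * ω * (t / (2 * Real.pi)) = -(ω * t) := by
      field_simp
    rw [this, Complex.exp_mul_I, ← Complex.ofReal_cos, ← Complex.ofReal_sin, Real.cos_neg,
      Real.sin_neg]
    push_cast
    simp only [smul_eq_mul]
    ring
  rw [Real.fourier_real_eq_integral_exp_smul]
  simp only [e]
  rw [integral_sub hc.ofReal (hs.ofReal.mul_const _), integral_mul_const, integral_complex_ofReal,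
    integral_complex_ofReal, hs0]
  simp [w]

theorem integrable_w {lam : ℕ} (hlam : 1 ≤ lam) : Integrable (w lam) := by
  have h := (((integrable_fourier_wHat hlam).comp_div
    (show 2 * Real.pi ≠ 0 by positivity)).smul ((2 * Real.pi)⁻¹ : ℝ)).re
  refine h.congr (Eventually.of_forall fun t => ?_)
  have := congrArg Complex.re (w_eq_fourier hlam t)
  simpa using! this.symm

/-- The Fourier transform of `w` is `exp(-|ω|^(2λ) / (2λ))`. -/
theorem fourier_w {lam : ℕ} (hlam : 1 ≤ lam) (ω : ℝ) :
    bilateralLaplace (w lam) (Complex.I * ω) = (wHat lam ω : ℂ) := by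
  have h0 : Integrable fun ω : ℝ => (wHat lam ω : ℂ) := by
    have := (integrable_pow_mul_wHat hlam 0).ofReal (𝕜 := ℂ)
    simpa using this
  have hcont : Continuous fun ω : ℝ => (wHat lam ω : ℂ) :=
    Complex.continuous_ofReal.comp
      (continuous_iff_continuousAt.mpr fun ω => (hasDerivAt_wHat hlam ω).continuousAt)
  have hinv := congrFun (hcont.fourierInv_fourier_eq h0 (integrable_fourier_wHat hlam)) (-ω)
  rw [Real.fourierInv_eq_fourier_neg, neg_neg, Real.fourier_real_eq_integral_exp_smul] at hinv
  have hw : wHat lam (-ω) = wHat lam ω := by simp [wHat]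
  simp only [hw] at hinv
  rw [← hinv, bilateralLaplace]
  have key := Measure.integral_comp_div (fun s : ℝ => ((2 * Real.pi)⁻¹ : ℝ) •
    (Complex.exp (↑(-2 * Real.pi * s * ω) * Complex.I) • 𝓕 (fun ω : ℝ => (wHat lam ω : ℂ)) s))
    (2 * Real.pi)
  rw [integral_smul _ (fun s : ℝ => Complex.exp (↑(-2 * Real.pi * s * ω) * Complex.I) •
    𝓕 (fun ω : ℝ => (wHat lam ω : ℂ)) s), smul_smul, abs_of_pos (by positivity),
    mul_inv_cancel₀ (by positivity), one_smul] at key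
  rw [← key]
  refine integral_congr_ae (Eventually.of_forall fun t => ?_)
  simp only
  rw [w_eq_fourier hlam]
  have : -2 * Real.pi * (t / (2 * Real.pi)) * ω = -(t * ω) := by field_simp
  rw [this]
  have e2 : -(Complex.I * (ω : ℂ)) * t = ((-(t * ω) : ℝ) : ℂ) * Complex.I := by
    push_cast; ring
  rw [e2, smul_mul_assoc, smul_eq_mul]
  congr 1
  exact mul_comm _ _

/-- The kernel `K(t) = ∑_{j=1}^{m+1} C(m+1, j) (-1)^(j+1) (1/j) w(t/j)`. -/
def kernelK (lam m : ℕ) (t : ℝ) : ℝ :=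
  ∑ j ∈ Finset.Icc 1 (m + 1),
    ((m + 1).choose j : ℝ) * (-1) ^ (j + 1) * (1 / (j : ℝ)) * w lam (t / j)

/-- The integrand of `L_{s,h}(x, y)` at the point `z = s + iω` of the line `Re z = s`. -/
def kernelLIntegrand (K g : ℝ → ℝ) (s h x y ω : ℝ) : ℂ :=
  ((|x / y| : ℝ) : ℂ) ^ ((s : ℂ) + ω * Complex.I)
    * (bilateralLaplace K (((s : ℂ) + ω * Complex.I) * h)
        / mellinR g (1 - ((s : ℂ) + ω * Complex.I)))

/-- The kernel `L_{s,h}(x, y) = (2πix)⁻¹ ∫_{Re z = s} |x/y|^z Ǩ(zh) / g̃(1-z) dz` for `y/x > 0`,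
and `0` otherwise (`dz = i dω` on the line `z = s + iω`). -/
def kernelL (K g : ℝ → ℝ) (s h x y : ℝ) : ℂ :=
  if 0 < y / x then (1 / (2 * Real.pi * x) : ℂ) * ∫ ω : ℝ, kernelLIntegrand K g s h x y ω else 0

/-- The estimator `n⁻¹ ∑ⱼ L_{s,h}(x₀, Yⱼ)`. -/
def estimator (K g : ℝ → ℝ) (s h x₀ : ℝ) (n : ℕ) (Y : Fin n → ℝ) : ℂ :=
  (1 / (n : ℂ)) * ∑ j, kernelL K g s h x₀ (Y j)

/-- The law of `Y = X η`, for independent `X` and `η` with densities `f` and `g`. -/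
def lawY (f g : ℝ → ℝ) : Measure ℝ :=
  ((volume.withDensity fun x => ENNReal.ofReal (f x)).prod
    (volume.withDensity fun x => ENNReal.ofReal (g x))).map fun p => p.1 * p.2

/-- The maximal risk at `x₀` over the class `S` of densities of `X`, of an estimator `T` built
from `n` independent observations of `Y = X η`, where `η` has density `g`:
`sup_{f ∈ S} (E_f |T(Y₁, …, Yₙ) - f(x₀)|²)^(1/2)`. -/
def maximalRisk (g : ℝ → ℝ) (x₀ : ℝ) (n : ℕ) (T : (Fin n → ℝ) → ℂ) (S : (ℝ → ℝ) → Prop) : ℝ≥0∞ :=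
  ⨆ (f : ℝ → ℝ) (_ : S f),
    (∫⁻ Y, ‖T Y - (f x₀ : ℂ)‖ₑ ^ (2 : ℝ) ∂(Measure.pi fun _ : Fin n => lawY f g)) ^ (1 / 2 : ℝ)

/-- The bandwidth `h_* = C₁ γ [ln(A² x₀^(2β+2) n)]^(-1 + 1/(2λ))`. -/
def bandwidth (C₁ γ A x₀ β : ℝ) (lam n : ℕ) : ℝ :=
  C₁ * γ * Real.log (A ^ 2 * x₀ ^ (2 * β + 2) * n) ^ (-1 + 1 / (2 * (lam : ℝ)))

/-- The rate `φₙ = A γ^β (ln n)^(-β (1 - 1/(2λ))) x₀^β`. -/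
def rate (γ A x₀ β : ℝ) (lam n : ℕ) : ℝ :=
  A * γ ^ β * Real.log n ^ (-β * (1 - 1 / (2 * (lam : ℝ)))) * x₀ ^ β

end

end MultDeconv

namespace MultDeconv

/-! ### The kernel and its Fourier transform -/

/-! The risk splits into bias and variance. With L = ln(A²x₀^(2β+2) n), the bandwidth
C₁γL^(-1+1/(2λ)) is wide enough that the variance is negligible, so the bias alone sets the rate.

Variance. Each summand of the estimator is at most (2πx₀)⁻¹ times the L¹ norm of the multiplier
K̂(ωh)/g̃(1-iω). Here |K̂(ωh)| is at most a constant times exp(-|ωh|^(2λ)/(2λ)), and 1/|g̃| is at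
most a polynomial times exp(γ|ω|). Young's inequality with exponents 2λ and q = 2λ/(2λ-1) bounds the
norm by a polynomial in 1/h times exp(2(γ/h)^q) (`exists_multiplier_bound`). At the chosen bandwidth
the exponent is 2C₁^(-q)L ≤ L/4 once C₁ ≥ 8, so the variance is at most a power of L times
e^(L/2)/n. Since e^L is proportional to n, this is smaller than any power of ln n. The constants of
g enter only here, which is why the final constant does not depend on g.

Bias. Averaging over η turns η^(-iω) into g̃(1-iω) and cancels the denominator, so the mean of the
estimator does not involve g (`integral_kernelL_lawY`). The substitution x = x₀e^(-jhu) writes the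
bias as a w-average of a finite difference of order m+1 (`integral_mul_smoothed`). In that
difference the Taylor polynomial of f at x₀ contributes O(|hu|^(m+1)), and the Hölder remainder
contributes A x₀^β |hu|^β up to a factor depending on β and m only
(`HolderClass.exists_difference_bound`). Where hu is too large for the expansion, the decay of w
gives O(h^(m+1)) (`exists_bias_bound`). As m+1 > β, only A x₀^β h^β survives in the limit. -/

theorem wHat_nonneg (lam : ℕ) (ω : ℝ) : 0 ≤ wHat lam ω := (Real.exp_pos _).le

theorem continuous_wHat (lam : ℕ) : Continuous (wHat lam) := by
  simp only [funext (wHat_eq lam)]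
  fun_prop

theorem wHat_neg (lam : ℕ) (ω : ℝ) : wHat lam (-ω) = wHat lam ω := by simp [wHat]

theorem wHat_le_of_abs_le (lam : ℕ) {s t : ℝ} (h : |s| ≤ |t|) : wHat lam t ≤ wHat lam s := by
  unfold wHat
  gcongr

theorem integrable_wHat {lam : ℕ} (hlam : 1 ≤ lam) : Integrable (wHat lam) := by
  simpa using! integrable_pow_mul_wHat hlam 0

theorem integrable_abs_pow_mul_wHat {lam : ℕ} (hlam : 1 ≤ lam) (k : ℕ) :
    Integrable fun ω : ℝ => |ω| ^ k * wHat lam ω := by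
  refine (integrable_pow_mul_wHat hlam k).norm.congr (Eventually.of_forall fun ω => ?_)
  simp [abs_of_nonneg (wHat_nonneg lam ω)]

/-- The signed binomial weights of the kernel. -/
def weight (m j : ℕ) : ℝ := ((m + 1).choose j : ℝ) * (-1) ^ (j + 1)

/-- The Fourier transform of the kernel. -/
noncomputable def kHat (lam m : ℕ) (ω : ℝ) : ℝ :=
  ∑ j ∈ Finset.Icc 1 (m + 1), weight m j * wHat lam (j * ω)

theorem abs_weight (m j : ℕ) : |weight m j| = (m + 1).choose j := by
  simp [weight, abs_mul]

theorem range_eq_insert_Icc (n : ℕ) : Finset.range (n + 1) = insert 0 (Finset.Icc 1 n) := by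
  ext x
  simp only [Finset.mem_range, Finset.mem_insert, Finset.mem_Icc]
  omega

theorem sum_abs_weight_le (m : ℕ) : ∑ j ∈ Finset.Icc 1 (m + 1), |weight m j| ≤ 2 ^ (m + 1) := by
  have h := Nat.sum_range_choose (m + 1)
  rw [range_eq_insert_Icc, Finset.sum_insert (by simp)] at h
  simp only [abs_weight]
  rw [← Nat.cast_sum]
  exact_mod_cast (show _ ≤ 2 ^ (m + 1) by omega)

/-- The binomial theorem for (1 - q)^(m+1) with its j = 0 term split off. The deviation from 1 has
order m+1 at q = 1, which is the source of the kernel's accuracy. -/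
theorem sum_weight_mul_pow (m : ℕ) (q : ℝ) :
    ∑ j ∈ Finset.Icc 1 (m + 1), weight m j * q ^ j = 1 - (1 - q) ^ (m + 1) := by
  have h := add_pow (-q) 1 (m + 1)
  rw [range_eq_insert_Icc, Finset.sum_insert (by simp)] at h
  have e : (1 - q) = -q + 1 := by ring
  rw [e, h, ← sub_eq_zero]
  simp only [pow_zero, one_pow, mul_one, Nat.choose_zero_right, Nat.cast_one, sub_add_cancel_left,
    sub_neg_eq_add]
  rw [← Finset.sum_add_distrib]
  refine Finset.sum_eq_zero fun j _ => ?_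
  rw [weight, neg_pow, pow_succ]
  ring

theorem continuous_kHat (lam m : ℕ) : Continuous (kHat lam m) := by
  have := continuous_wHat lam
  unfold kHat
  fun_prop

/-- `wHat` decreases in |ω| and every dilation factor j is at least 1, so each dilate lies below
`wHat` itself. -/
theorem abs_kHat_le (lam m : ℕ) (ω : ℝ) : |kHat lam m ω| ≤ 2 ^ (m + 1) * wHat lam ω := by
  calc |kHat lam m ω| ≤ ∑ j ∈ Finset.Icc 1 (m + 1), |weight m j * wHat lam (j * ω)| :=
        Finset.abs_sum_le_sum_abs _ _
    _ ≤ ∑ j ∈ Finset.Icc 1 (m + 1), |weight m j| * wHat lam ω := by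
        refine Finset.sum_le_sum fun j hj => ?_
        rw [abs_mul, abs_of_nonneg (wHat_nonneg _ _)]
        refine mul_le_mul_of_nonneg_left (wHat_le_of_abs_le _ ?_) (abs_nonneg _)
        have : (1 : ℝ) ≤ j := by exact_mod_cast (Finset.mem_Icc.mp hj).1
        rw [abs_mul, abs_of_nonneg (by linarith : (0 : ℝ) ≤ j)]
        nlinarith [abs_nonneg ω]
    _ ≤ _ := by
        rw [← Finset.sum_mul]
        exact mul_le_mul_of_nonneg_right (sum_abs_weight_le m) (wHat_nonneg _ _)

/-- Passing from w(t/j) to w costs a Jacobian j, which the factor 1/j in the kernel cancels. -/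
theorem bilateralLaplace_kernelK {lam : ℕ} (hlam : 1 ≤ lam) (m : ℕ) (ω : ℝ) :
    bilateralLaplace (kernelK lam m) (Complex.I * ω) = (kHat lam m ω : ℂ) := by
  have hint : ∀ j : ℕ, Integrable fun s : ℝ => (w lam s : ℂ) *
      Complex.exp (-(Complex.I * ((j * ω : ℝ) : ℂ)) * s) := fun j => by
    refine (integrable_w hlam).ofReal.mul_bdd (c := 1) (by fun_prop)
      (Eventually.of_forall fun s => ?_)
    have : -(Complex.I * ((j * ω : ℝ) : ℂ)) * s = ((-(j * ω * s) : ℝ) : ℂ) * Complex.I := by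
      push_cast; ring
    rw [this, Complex.norm_exp_ofReal_mul_I]
  have e : ∀ t : ℝ, (kernelK lam m t : ℂ) * Complex.exp (-(Complex.I * ω) * t) =
      ∑ j ∈ Finset.Icc 1 (m + 1), ((weight m j * (1 / (j : ℝ)) : ℝ) : ℂ) *
        ((w lam (t / j) : ℂ) *
          Complex.exp (-(Complex.I * ((j * ω : ℝ) : ℂ)) * ((t / j : ℝ) : ℂ))) := fun t => by
    rw [kernelK, Complex.ofReal_sum, Finset.sum_mul]
    refine Finset.sum_congr rfl fun j hj => ?_
    have hj0 : (j : ℂ) ≠ 0 := by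
      have := (Finset.mem_Icc.mp hj).1
      exact_mod_cast (by omega : j ≠ 0)
    have : -(Complex.I * ((j * ω : ℝ) : ℂ)) * ((t / j : ℝ) : ℂ) = -(Complex.I * ω) * t := by
      push_cast
      field_simp
    rw [this, weight]
    push_cast
    ring
  rw [bilateralLaplace]
  simp only [e]
  rw [integral_finsetSum]
  · rw [kHat, Complex.ofReal_sum]
    refine Finset.sum_congr rfl fun j hj => ?_
    have hj0 : (0 : ℝ) < j := by
      have := (Finset.mem_Icc.mp hj).1
      exact_mod_cast (by omega : 0 < j)
    rw [integral_const_mul, Measure.integral_comp_div (fun s : ℝ => (w lam s : ℂ) *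
      Complex.exp (-(Complex.I * ((j * ω : ℝ) : ℂ)) * s)) (j : ℝ), abs_of_pos hj0]
    have := fourier_w hlam (j * ω)
    rw [bilateralLaplace] at this
    rw [this, Complex.real_smul]
    have hjC : (j : ℂ) ≠ 0 := by exact_mod_cast hj0.ne'
    push_cast
    field_simp
  · intro j hj
    have hj0 : (j : ℝ) ≠ 0 := by
      have := (Finset.mem_Icc.mp hj).1
      exact_mod_cast (by omega : j ≠ 0)
    exact ((hint j).comp_div hj0).const_mul _

/-! ### Decay of `w` -/

/-- Differentiation acts on the polynomial factor by p ↦ p' - X^(2λ-1) p. -/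
theorem exists_iteratedDeriv_wHat {lam : ℕ} (hlam : 1 ≤ lam) (n : ℕ) :
    ∃ p : Polynomial ℝ, iteratedDeriv n (fun ω : ℝ => (wHat lam ω : ℂ)) =
      fun ω => ((p.eval ω * wHat lam ω : ℝ) : ℂ) := by
  induction n with
  | zero => exact ⟨1, by simp⟩
  | succ n ih =>
    obtain ⟨p, hp⟩ := ih
    refine ⟨p.derivative - Polynomial.X ^ (2 * lam - 1) * p, ?_⟩
    rw [iteratedDeriv_succ, hp]
    funext ω
    refine ((p.hasDerivAt ω).mul (hasDerivAt_wHat hlam ω)).ofReal_comp.deriv.trans ?_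
    congr 1
    simp
    ring

theorem integrable_polynomial_mul_wHat {lam : ℕ} (hlam : 1 ≤ lam) (p : Polynomial ℝ) :
    Integrable fun ω : ℝ => p.eval ω * wHat lam ω := by
  simp only [Polynomial.eval_eq_sum_range, Finset.sum_mul]
  refine integrable_finsetSum _ fun k _ => ?_
  simpa only [mul_assoc] using (integrable_pow_mul_wHat hlam k).const_mul (p.coeff k)

/-- Decay from smoothness: multiplying w by t^k corresponds to differentiating `wHat` k times, and
the Fourier transform of an integrable function is bounded. -/
theorem exists_abs_w_mul_pow_le {lam : ℕ} (hlam : 1 ≤ lam) (k : ℕ) :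
    ∃ C : ℝ, 0 ≤ C ∧ ∀ t : ℝ, |w lam t| * |t| ^ k ≤ C := by
  set φ : ℝ → ℂ := fun ω => (wHat lam ω : ℂ) with hφ
  have hsm : ContDiff ℝ (k : ℕ∞) φ := by
    have hw : ContDiff ℝ (k : ℕ∞) (wHat lam) := by
      rw [funext (wHat_eq lam)]
      fun_prop
    exact Complex.ofRealCLM.contDiff.comp hw
  have hint : ∀ n : ℕ, Integrable (iteratedDeriv n φ) := fun n => by
    obtain ⟨p, hp⟩ := exists_iteratedDeriv_wHat hlam n
    rw [hp]
    exact (integrable_polynomial_mul_wHat hlam p).ofReal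
  have hF := Real.fourier_iteratedDeriv (n := k) hsm (fun n _ => hint n) le_rfl
  refine ⟨(2 * Real.pi)⁻¹ * ∫ v, ‖iteratedDeriv k φ v‖, by positivity, fun t => ?_⟩
  have h1 : ‖𝓕 (iteratedDeriv k φ) (t / (2 * Real.pi))‖ ≤ ∫ v, ‖iteratedDeriv k φ v‖ :=
    VectorFourier.norm_fourierIntegral_le_integral_norm _ _ _ _ _
  have h2 : 2 * Real.pi * Complex.I * ((t / (2 * Real.pi) : ℝ) : ℂ) = Complex.I * t := by
    have : (Real.pi : ℂ) ≠ 0 := by exact_mod_cast Real.pi_ne_zero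
    push_cast
    field_simp
  rw [hF] at h1
  beta_reduce at h1
  rw [h2, norm_smul, norm_pow, norm_mul, Complex.norm_I, Complex.norm_real, one_mul,
    Real.norm_eq_abs] at h1
  have h3 : |w lam t| = (2 * Real.pi)⁻¹ * ‖𝓕 φ (t / (2 * Real.pi))‖ := by
    have := congrArg norm (w_eq_fourier hlam t)
    rw [Complex.norm_real, norm_smul, Real.norm_eq_abs, Real.norm_eq_abs,
      abs_of_pos (by positivity : (0 : ℝ) < (2 * Real.pi)⁻¹)] at this
    exact this
  rw [h3, mul_assoc, mul_comm _ (|t| ^ k)]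
  exact mul_le_mul_of_nonneg_left h1 (by positivity)

theorem integrable_abs_w_mul_pow {lam : ℕ} (hlam : 1 ≤ lam) (k : ℕ) :
    Integrable fun t : ℝ => |w lam t| * |t| ^ k := by
  obtain ⟨C₁, -, h1⟩ := exists_abs_w_mul_pow_le hlam k
  obtain ⟨C₂, -, h2⟩ := exists_abs_w_mul_pow_le hlam (k + 2)
  refine (integrable_inv_one_add_sq.const_mul (C₁ + C₂)).mono'
    ((integrable_w hlam).abs.aestronglyMeasurable.mul (by fun_prop))
    (Eventually.of_forall fun t => ?_)
  rw [Real.norm_of_nonneg (by positivity), ← div_eq_mul_inv, le_div_iff₀ (by positivity)]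
  have h1 := h1 t
  have h2 := h2 t
  rw [pow_add, sq_abs] at h2
  nlinarith

theorem integral_w {lam : ℕ} (hlam : 1 ≤ lam) : ∫ t : ℝ, w lam t = 1 := by
  have := fourier_w hlam 0
  simp only [bilateralLaplace, Complex.ofReal_zero, mul_zero, neg_zero, zero_mul, Complex.exp_zero,
    mul_one, integral_complex_ofReal, wHat] at this
  have hl : lam ≠ 0 := by omega
  simpa [hl] using this

/-- Fourier inversion for the dilates of `w`. -/
theorem integral_wHat_mul_exp {lam : ℕ} (hlam : 1 ≤ lam) {a : ℝ} (ha : 0 < a) (s : ℝ) :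
    ∫ ω : ℝ, (wHat lam (a * ω) : ℂ) * Complex.exp ((ω * s : ℝ) * Complex.I) =
      ((2 * Real.pi * (a⁻¹ * w lam (s / a)) : ℝ) : ℂ) := by
  have h0 : Integrable (wHat lam) := integrable_wHat hlam
  have key : ∀ t : ℝ, ∫ ω : ℝ, (wHat lam ω : ℂ) * Complex.exp ((ω * t : ℝ) * Complex.I) =
      ((2 * Real.pi * w lam t : ℝ) : ℂ) := fun t => by
    have hc : Integrable fun ω : ℝ => wHat lam ω * Real.cos (ω * t) :=
      h0.mul_bdd (c := 1) (by fun_prop)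
        (Eventually.of_forall fun ω => by simpa using Real.abs_cos_le_one _)
    have hs : Integrable fun ω : ℝ => wHat lam ω * Real.sin (ω * t) :=
      h0.mul_bdd (c := 1) (by fun_prop)
        (Eventually.of_forall fun ω => by simpa using Real.abs_sin_le_one _)
    have hs0 : ∫ ω : ℝ, wHat lam ω * Real.sin (ω * t) = 0 := by
      have := integral_neg_eq_self (fun ω : ℝ => wHat lam ω * Real.sin (ω * t)) volume
      simp only [neg_mul, Real.sin_neg, mul_neg, integral_neg, wHat_neg] at this
      linarith
    have e : ∀ ω : ℝ, (wHat lam ω : ℂ) * Complex.exp ((ω * t : ℝ) * Complex.I) =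
        ((wHat lam ω * Real.cos (ω * t) : ℝ) : ℂ)
          + ((wHat lam ω * Real.sin (ω * t) : ℝ) : ℂ) * Complex.I := fun ω => by
      rw [Complex.exp_mul_I, ← Complex.ofReal_cos, ← Complex.ofReal_sin]
      push_cast
      ring
    simp only [e]
    rw [integral_add hc.ofReal (hs.ofReal.mul_const _), integral_mul_const, integral_complex_ofReal,
      integral_complex_ofReal, hs0, w]
    have : (2 * Real.pi) ≠ 0 := by positivity
    rw [← mul_assoc, mul_inv_cancel₀ this]
    simp
  have := Measure.integral_comp_mul_left (fun ω : ℝ => (wHat lam ω : ℂ) *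
    Complex.exp ((ω * (s / a) : ℝ) * Complex.I)) a
  rw [key, abs_of_pos (by positivity)] at this
  rw [Complex.real_smul, ← Complex.ofReal_mul] at this
  rw [show 2 * Real.pi * (a⁻¹ * w lam (s / a)) = a⁻¹ * (2 * Real.pi * w lam (s / a)) by ring,
    ← this]
  refine integral_congr_ae (Eventually.of_forall fun ω => ?_)
  simp only
  rw [show a * ω * (s / a) = ω * s by field_simp]

/-! ### The deconvolution kernel -/

/-- Young's inequality for T/s and as, with s = 2^(1/p) and p = 2λ. This s halves the T-term, so
that half of the exponent of `wHat` is left over. -/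
theorem mul_le_pow_add_rpow {lam : ℕ} (hlam : 1 ≤ lam) {a T : ℝ} (ha : 0 ≤ a) (hT : 0 ≤ T) :
    a * T ≤ T ^ (2 * lam) / (2 * (2 * lam))
      + 2 * a ^ ((2 * lam : ℝ) / (2 * lam - 1)) := by
  have hl : (1 : ℝ) ≤ lam := by exact_mod_cast hlam
  set p : ℝ := 2 * lam with hp
  have hp1 : 1 < p := by linarith
  have hpp : 0 < p := by linarith
  have hc : p.HolderConjugate (p / (p - 1)) := Real.HolderConjugate.conjExponent hp1
  set q := p / (p - 1) with hq
  have hq1 : 1 < q := hc.symm.lt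
  set s : ℝ := 2 ^ (1 / p) with hs
  have hs0 : 0 < s := by positivity
  have hy := Real.young_inequality_of_nonneg (a := T / s) (b := a * s) (by positivity)
    (by positivity) hc
  have e1 : T / s * (a * s) = a * T := by field_simp
  have e2 : (T / s) ^ p = T ^ (2 * lam) / 2 := by
    rw [Real.div_rpow hT hs0.le, hs, ← Real.rpow_mul (by norm_num), one_div_mul_cancel hpp.ne',
      Real.rpow_one, hp]
    congr 1
    exact_mod_cast Real.rpow_natCast T (2 * lam)
  -- The exponent is q/p = 1/(p-1) ≤ 1.
  have e3 : s ^ q ≤ 2 := by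
    rw [hs, ← Real.rpow_mul (by norm_num)]
    have : 1 / p * q ≤ 1 := by
      rw [hq, div_mul_div_comm, one_mul, div_le_one (by nlinarith)]
      nlinarith
    calc (2 : ℝ) ^ (1 / p * q) ≤ 2 ^ (1 : ℝ) := Real.rpow_le_rpow_of_exponent_le (by norm_num) this
      _ = 2 := Real.rpow_one 2
  have e4 : (a * s) ^ q / q ≤ 2 * a ^ q := by
    rw [Real.mul_rpow ha hs0.le, div_le_iff₀ (by linarith)]
    have h0 : 0 ≤ a ^ q := by positivity
    nlinarith [mul_le_mul_of_nonneg_left e3 h0, mul_nonneg h0 (by linarith : (0 : ℝ) ≤ q - 1)]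
  rw [e1, e2, div_div] at hy
  linarith

/-- Half of the exponent of `wHat` absorbs the exponential; the other half still dominates that of
the dilate at T/2, which keeps the bound integrable. -/
theorem exp_mul_wHat_le {lam : ℕ} (hlam : 1 ≤ lam) {a : ℝ} (ha : 0 ≤ a) (T : ℝ) :
    Real.exp (a * |T|) * wHat lam T ≤
      Real.exp (2 * a ^ ((2 * lam : ℝ) / (2 * lam - 1))) * wHat lam (T / 2) := by
  have hl : (1 : ℝ) ≤ lam := by exact_mod_cast hlam
  have h := mul_le_pow_add_rpow hlam ha (abs_nonneg T)
  rw [wHat, wHat, ← Real.exp_add, ← Real.exp_add, Real.exp_le_exp, abs_div, div_pow]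
  have h2 : |T| ^ (2 * lam) / |2| ^ (2 * lam) ≤ |T| ^ (2 * lam) / 2 := by
    rw [abs_two]
    gcongr
    exact le_self_pow₀ (by norm_num) (by omega)
  have h3 : |T| ^ (2 * lam) / (2 * (2 * lam)) = |T| ^ (2 * lam) / 2 / (2 * lam) := by
    rw [div_div]
  have h4 : |T| ^ (2 * lam) / |2| ^ (2 * lam) / (2 * lam) ≤ |T| ^ (2 * lam) / 2 / (2 * lam) := by
    gcongr
  rw [neg_div, neg_div]
  have h5 : |T| ^ (2 * lam) / (2 * lam) = |T| ^ (2 * lam) / 2 / (2 * lam)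
    + |T| ^ (2 * lam) / 2 / (2 * lam) := by ring
  linarith

theorem SuperSmooth.inv_norm_mellin_le {g : ℝ → ℝ} {γ : ℝ} (hg : SuperSmooth g 1 γ) :
    ∃ (D : ℝ) (k : ℕ), 0 ≤ D ∧ ∀ ω : ℝ, mellinR g (1 - ω * Complex.I) ≠ 0 ∧
      ‖mellinR g (1 - ω * Complex.I)‖⁻¹ ≤ D * (1 + |ω| ^ k) * Real.exp (γ * |ω|) := by
  obtain ⟨hγ, c₀, ω₀, ν, B₁, B₂, hc₀, hω₀, hB₁, -, hlow, hhigh⟩ := hg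
  -- The sign of ν is arbitrary. With k ≥ -ν the power |ω|^(-ν-k) is nonincreasing, hence bounded
  -- beyond ω₀ by its value there, and |ω|^k takes the place of |ω|^(-ν).
  obtain ⟨k, hk⟩ := exists_nat_ge (-ν)
  refine ⟨c₀⁻¹ + B₁⁻¹ * ω₀ ^ (-ν - k), k, by positivity, fun ω => ?_⟩
  have e : (1 : ℂ) - ω * Complex.I = ((1 : ℝ) : ℂ) + ((-ω : ℝ) : ℂ) * Complex.I := by
    push_cast; ring
  rw [e]
  have hexp : 1 ≤ Real.exp (γ * |ω|) := Real.one_le_exp (by positivity)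
  rcases le_total |ω| ω₀ with h | h
  · have hb := hlow (-ω) (by rwa [abs_neg])
    refine ⟨norm_pos_iff.mp (hc₀.trans_le hb), ?_⟩
    calc _ ≤ c₀⁻¹ := inv_anti₀ hc₀ hb
      _ = c₀⁻¹ * 1 * 1 := by ring
      _ ≤ _ := by
        gcongr
        · exact le_add_of_nonneg_right (by positivity)
        · exact le_add_of_nonneg_right (by positivity)
  · have hb := (hhigh (-ω) (by rwa [abs_neg])).1
    rw [abs_neg] at hb
    have hω : 0 < |ω| := hω₀.trans_le h
    have hpos : 0 < B₁ * |ω| ^ ν * Real.exp (-γ * |ω|) := by positivity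
    refine ⟨norm_pos_iff.mp (hpos.trans_le hb), ?_⟩
    have h1 : |ω| ^ (-ν) ≤ ω₀ ^ (-ν - k) * |ω| ^ k := by
      have h2 : |ω| ^ (-ν - k) ≤ ω₀ ^ (-ν - k) :=
        Real.rpow_le_rpow_of_nonpos hω₀ h (by linarith)
      calc |ω| ^ (-ν) = |ω| ^ (-ν - k) * |ω| ^ k := by
            rw [← Real.rpow_natCast, ← Real.rpow_add hω]
            congr 1
            ring
        _ ≤ _ := by gcongr
    calc _ ≤ (B₁ * |ω| ^ ν * Real.exp (-γ * |ω|))⁻¹ := inv_anti₀ hpos hb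
      _ = B₁⁻¹ * |ω| ^ (-ν) * Real.exp (γ * |ω|) := by
        rw [mul_inv, mul_inv, Real.rpow_neg hω.le, neg_mul, Real.exp_neg, inv_inv]
      _ ≤ B₁⁻¹ * (ω₀ ^ (-ν - k) * |ω| ^ k) * Real.exp (γ * |ω|) := by gcongr
      _ ≤ _ := by
        refine mul_le_mul_of_nonneg_right ?_ (Real.exp_pos _).le
        have : 0 ≤ B₁⁻¹ * ω₀ ^ (-ν - k) := by positivity
        have : 0 ≤ |ω| ^ k := by positivity
        have : 0 ≤ c₀⁻¹ * |ω| ^ k := by positivity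
        have : 0 ≤ c₀⁻¹ := by positivity
        nlinarith

/-- The ratio of the Fourier transform of the kernel and the Mellin transform of the error. -/
noncomputable def multiplier (lam m : ℕ) (g : ℝ → ℝ) (h ω : ℝ) : ℂ :=
  (kHat lam m (ω * h) : ℂ) / mellinR g (1 - ω * Complex.I)

theorem kernelLIntegrand_eq {lam : ℕ} (hlam : 1 ≤ lam) (m : ℕ) (g : ℝ → ℝ) (h : ℝ) {x y : ℝ}
    (hx : 0 < x) (hy : 0 < y) (ω : ℝ) :
    kernelLIntegrand (kernelK lam m) g 0 h x y ω =
      Complex.exp ((ω * Real.log (x / y) : ℝ) * Complex.I) * multiplier lam m g h ω := by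
  have hxy : 0 < x / y := by positivity
  have e : (((0 : ℝ) : ℂ) + ω * Complex.I) * h = Complex.I * ((ω * h : ℝ) : ℂ) := by
    push_cast; ring
  rw [kernelLIntegrand, e, bilateralLaplace_kernelK hlam, multiplier, Complex.ofReal_zero, zero_add,
    abs_of_pos hxy, Complex.cpow_def_of_ne_zero (by exact_mod_cast hxy.ne'), ← Complex.ofReal_log hxy.le]
  congr 2
  push_cast
  ring

theorem measurable_mellinR {g : ℝ → ℝ} (hg : Measurable g) :
    StronglyMeasurable fun ω : ℝ => mellinR g (1 - ω * Complex.I) := by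
  have : Measurable (Function.uncurry fun (ω t : ℝ) =>
      (t : ℂ) ^ ((1 : ℂ) - ω * Complex.I - 1) • (g t : ℂ)) := by
    unfold Function.uncurry
    simp only [smul_eq_mul]
    fun_prop
  exact this.stronglyMeasurable.integral_prod_right

theorem measurable_multiplier (lam m : ℕ) {g : ℝ → ℝ} (hg : Measurable g) (h : ℝ) :
    Measurable (multiplier lam m g h) := by
  have h1 := (measurable_mellinR hg).measurable
  have h2 := (continuous_kHat lam m).measurable
  unfold multiplier
  fun_prop

/-- The constants precede h, so the dependence on the bandwidth is explicit. They may depend on g,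
because the exponential saving in the variance outweighs them. -/
theorem exists_multiplier_bound {lam : ℕ} (hlam : 1 ≤ lam) (m : ℕ) {g : ℝ → ℝ} {γ : ℝ}
    (hg : Measurable g) (hs : SuperSmooth g 1 γ) :
    ∃ (C : ℝ) (k : ℕ), 0 ≤ C ∧ ∀ h : ℝ, 0 < h → Integrable (multiplier lam m g h) ∧
      ∫ ω, ‖multiplier lam m g h ω‖ ≤
        C * (2 / h + (2 / h) ^ (k + 1)) * Real.exp (2 * (γ / h) ^ ((2 * lam : ℝ) / (2 * lam - 1))) := by
  obtain ⟨D, k, hD, hmel⟩ := hs.inv_norm_mellin_le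
  have hγ := hs.1
  set I₀ := ∫ t : ℝ, wHat lam t
  set I₁ := ∫ t : ℝ, |t| ^ k * wHat lam t
  have hI₀ : 0 ≤ I₀ := integral_nonneg fun t => wHat_nonneg _ _
  have hI₁ : 0 ≤ I₁ := integral_nonneg fun t => mul_nonneg (by positivity) (wHat_nonneg _ _)
  refine ⟨2 ^ (m + 1) * D * (I₀ + I₁), k, by positivity, fun h hh => ?_⟩
  set E := Real.exp (2 * (γ / h) ^ ((2 * lam : ℝ) / (2 * lam - 1)))
  have hpt : ∀ ω, ‖multiplier lam m g h ω‖ ≤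
      2 ^ (m + 1) * D * E * ((1 + |ω| ^ k) * wHat lam (ω * (h / 2))) := fun ω => by
    rw [multiplier, norm_div, Complex.norm_real, Real.norm_eq_abs, div_eq_mul_inv]
    have h1 := abs_kHat_le lam m (ω * h)
    have h2 := (hmel ω).2
    have h3 := exp_mul_wHat_le hlam (div_pos hγ hh).le (ω * h)
    have e1 : γ / h * |ω * h| = γ * |ω| := by
      rw [abs_mul, abs_of_pos hh]; field_simp
    rw [e1] at h3
    have hw := wHat_nonneg lam (ω * h)
    calc _ ≤ (2 ^ (m + 1) * wHat lam (ω * h)) * (D * (1 + |ω| ^ k) * Real.exp (γ * |ω|)) := by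
          gcongr
      _ = 2 ^ (m + 1) * D * (1 + |ω| ^ k) * (Real.exp (γ * |ω|) * wHat lam (ω * h)) := by ring
      _ ≤ 2 ^ (m + 1) * D * (1 + |ω| ^ k) * (E * wHat lam (ω * h / 2)) := by gcongr
      _ = _ := by rw [mul_div_assoc]; ring
  have hsc : ∀ ω : ℝ, (1 + |ω| ^ k) * wHat lam (ω * (h / 2)) =
      (fun t => wHat lam t + (2 / h) ^ k * (|t| ^ k * wHat lam t)) (ω * (h / 2)) := fun ω => by
    simp only
    rw [abs_mul, abs_of_pos (by positivity : 0 < h / 2), mul_pow]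
    have : (2 / h) ^ k * (h / 2) ^ k = 1 := by
      rw [← mul_pow]; field_simp; simp
    linear_combination (-(|ω| ^ k * wHat lam (ω * (h / 2)))) * this
  have hi0 := integrable_wHat hlam
  have hi1 := (integrable_abs_pow_mul_wHat hlam k).const_mul ((2 / h) ^ k)
  have hint : Integrable fun ω : ℝ => (1 + |ω| ^ k) * wHat lam (ω * (h / 2)) := by
    simp only [hsc]
    exact Integrable.comp_mul_right' (hi0.add hi1) (by positivity)
  have hI : ∫ ω : ℝ, (1 + |ω| ^ k) * wHat lam (ω * (h / 2)) = 2 / h * (I₀ + (2 / h) ^ k * I₁) := by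
    refine (integral_congr_ae (Eventually.of_forall hsc)).trans
      ((Measure.integral_comp_mul_right
        (fun t => wHat lam t + (2 / h) ^ k * (|t| ^ k * wHat lam t)) (h / 2)).trans ?_)
    rw [abs_of_pos (by positivity), integral_add hi0 hi1,
      integral_const_mul, inv_div, smul_eq_mul]
  have hmeas := (measurable_multiplier lam m hg h).aestronglyMeasurable (μ := volume)
  refine ⟨(hint.const_mul _).mono' hmeas (Eventually.of_forall hpt), ?_⟩
  calc _ ≤ ∫ ω, 2 ^ (m + 1) * D * E * ((1 + |ω| ^ k) * wHat lam (ω * (h / 2))) :=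
        integral_mono_of_nonneg (Eventually.of_forall fun _ => norm_nonneg _) (hint.const_mul _)
          (Eventually.of_forall hpt)
    _ = 2 ^ (m + 1) * D * (2 / h * I₀ + (2 / h) ^ (k + 1) * I₁) * E := by
        rw [integral_const_mul, hI]; ring
    _ ≤ _ := by
        have : 2 / h * I₀ + (2 / h) ^ (k + 1) * I₁ ≤ (I₀ + I₁) * (2 / h + (2 / h) ^ (k + 1)) := by
          have : 0 ≤ 2 / h * I₁ := by positivity
          have : 0 ≤ (2 / h) ^ (k + 1) * I₀ := by positivity
          linarith
        have := mul_le_mul_of_nonneg_left this (by positivity : 0 ≤ 2 ^ (m + 1) * D)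
        refine mul_le_mul_of_nonneg_right (this.trans_eq ?_) (Real.exp_pos _).le
        ring

theorem integrable_exp_mul_multiplier {lam m : ℕ} {g : ℝ → ℝ} {h : ℝ}
    (hi : Integrable (multiplier lam m g h)) (s : ℝ) :
    Integrable fun ω : ℝ => Complex.exp ((ω * s : ℝ) * Complex.I) * multiplier lam m g h ω :=
  hi.bdd_mul (c := 1) (by fun_prop)
    (Eventually.of_forall fun ω => by rw [Complex.norm_exp_ofReal_mul_I])

theorem kernelL_eq {lam : ℕ} (hlam : 1 ≤ lam) (m : ℕ) (g : ℝ → ℝ) (h : ℝ) {x : ℝ} (hx : 0 < x)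
    (y : ℝ) :
    kernelL (kernelK lam m) g 0 h x y = if 0 < y then (1 / (2 * Real.pi * x) : ℂ) *
      ∫ ω : ℝ, Complex.exp ((ω * Real.log (x / y) : ℝ) * Complex.I) * multiplier lam m g h ω
      else 0 := by
  rw [kernelL]
  by_cases hy : 0 < y
  · rw [if_pos (div_pos hy hx), if_pos hy]
    simp only [kernelLIntegrand_eq hlam m g h hx hy]
  · rw [if_neg hy, if_neg]
    exact fun h' => hy ((div_pos_iff_of_pos_right hx).mp h')

theorem norm_kernelL_le {lam : ℕ} (hlam : 1 ≤ lam) (m : ℕ) (g : ℝ → ℝ) (h : ℝ) {x : ℝ}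
    (hx : 0 < x) (y : ℝ) :
    ‖kernelL (kernelK lam m) g 0 h x y‖ ≤
      (2 * Real.pi * x)⁻¹ * ∫ ω, ‖multiplier lam m g h ω‖ := by
  have hI : 0 ≤ ∫ ω, ‖multiplier lam m g h ω‖ := integral_nonneg fun _ => norm_nonneg _
  rw [kernelL_eq hlam m g h hx]
  split_ifs with hy
  · have e : (1 / (2 * Real.pi * x) : ℂ) = (((2 * Real.pi * x)⁻¹ : ℝ) : ℂ) := by push_cast; ring
    rw [norm_mul, e, Complex.norm_real, Real.norm_of_nonneg (by positivity)]
    refine mul_le_mul_of_nonneg_left ((norm_integral_le_integral_norm _).trans_eq ?_) (by positivity)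
    simp only [norm_mul, Complex.norm_exp_ofReal_mul_I, one_mul]
  · rw [norm_zero]
    positivity

theorem measurable_kernelL {lam : ℕ} (hlam : 1 ≤ lam) (m : ℕ) {g : ℝ → ℝ} (hg : Measurable g)
    (h : ℝ) {x : ℝ} (hx : 0 < x) :
    Measurable (kernelL (kernelK lam m) g 0 h x) := by
  rw [funext (kernelL_eq hlam m g h hx)]
  refine Measurable.ite measurableSet_Ioi (Measurable.const_mul ?_ _) measurable_const
  have hm := measurable_multiplier lam m hg h
  have : Measurable (Function.uncurry fun (y ω : ℝ) =>
      Complex.exp ((ω * Real.log (x / y) : ℝ) * Complex.I) * multiplier lam m g h ω) := by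
    unfold Function.uncurry
    fun_prop
  exact this.stronglyMeasurable.integral_prod_right.measurable

/-! ### The expectation of the estimator -/

theorem IsDensityOnNonneg.integrable {f : ℝ → ℝ} (hf : IsDensityOnNonneg f) : Integrable f := by
  refine ⟨hf.measurable.aestronglyMeasurable, ?_⟩
  rw [hasFiniteIntegral_iff_ofReal (Eventually.of_forall hf.nonneg), hf.lintegral_eq_one]
  exact ENNReal.one_lt_top

theorem IsDensityOnNonneg.integral_eq_one {f : ℝ → ℝ} (hf : IsDensityOnNonneg f) :
    ∫ x, f x = 1 := by
  rw [integral_eq_lintegral_of_nonneg_ae (Eventually.of_forall hf.nonneg)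
    hf.measurable.aestronglyMeasurable, hf.lintegral_eq_one, ENNReal.toReal_one]

theorem IsDensityOnNonneg.isProbabilityMeasure {f : ℝ → ℝ} (hf : IsDensityOnNonneg f) :
    IsProbabilityMeasure (volume.withDensity fun x => ENNReal.ofReal (f x)) :=
  ⟨by rw [withDensity_apply _ MeasurableSet.univ, setLIntegral_univ, hf.lintegral_eq_one]⟩

theorem isProbabilityMeasure_lawY {f g : ℝ → ℝ} (hf : IsDensityOnNonneg f)
    (hg : IsDensityOnNonneg g) : IsProbabilityMeasure (lawY f g) := by
  have := hf.isProbabilityMeasure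
  have := hg.isProbabilityMeasure
  exact Measure.isProbabilityMeasure_map (by fun_prop)

theorem IsDensityOnNonneg.integral_withDensity {f : ℝ → ℝ} (hf : IsDensityOnNonneg f)
    (φ : ℝ → ℂ) :
    ∫ x, φ x ∂(volume.withDensity fun x => ENNReal.ofReal (f x)) =
      ∫ x in Set.Ioi 0, (f x : ℂ) * φ x := by
  rw [integral_withDensity_eq_integral_toReal_smul hf.measurable.ennreal_ofReal
    (Eventually.of_forall fun _ => ENNReal.ofReal_lt_top), ← integral_Ici_eq_integral_Ioi]
  rw [← setIntegral_eq_integral_of_forall_compl_eq_zero (s := Set.Ici 0)]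
  · refine integral_congr_ae (Eventually.of_forall fun x => ?_)
    simp [ENNReal.toReal_ofReal (hf.nonneg x)]
  · intro x hx
    simp [hf.support_nonneg x (by simpa using hx)]

/-- The mean of the deconvolution kernel given `X = x`. -/
noncomputable def smoothed (lam m : ℕ) (h x₀ x : ℝ) : ℝ :=
  x₀⁻¹ * ∑ j ∈ Finset.Icc 1 (m + 1),
    weight m j * ((j * h)⁻¹ * w lam (Real.log (x₀ / x) / (j * h)))

theorem exp_log_mul_eq_cpow {x₀ x η : ℝ} (hx₀ : 0 < x₀) (hx : 0 < x) (hη : 0 < η) (ω : ℝ) :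
    Complex.exp ((ω * Real.log (x₀ / (x * η)) : ℝ) * Complex.I) =
      Complex.exp ((ω * Real.log (x₀ / x) : ℝ) * Complex.I)
        * (η : ℂ) ^ (1 - ω * Complex.I - 1 : ℂ) := by
  rw [Complex.cpow_def_of_ne_zero (by exact_mod_cast hη.ne'), ← Complex.ofReal_log hη.le,
    ← Complex.exp_add, ← div_div, Real.log_div (by positivity) hη.ne']
  congr 1
  push_cast
  ring

/-- After Fubini the η-integral produces g̃(1-iω), which is nonzero and cancels the denominator;
Fourier inversion of each dilate of `wHat` then returns a dilate of `w`. -/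
theorem integral_kernelL_mul {lam : ℕ} (hlam : 1 ≤ lam) (m : ℕ) {g : ℝ → ℝ}
    (hg : IsDensityOnNonneg g) {h : ℝ} (hh : 0 < h) (hi : Integrable (multiplier lam m g h))
    (hne : ∀ ω : ℝ, mellinR g (1 - ω * Complex.I) ≠ 0)
    {x₀ x : ℝ} (hx₀ : 0 < x₀) (hx : 0 < x) :
    ∫ η, kernelL (kernelK lam m) g 0 h x₀ (x * η)
      ∂(volume.withDensity fun x => ENNReal.ofReal (g x)) = (smoothed lam m h x₀ x : ℂ) := by
  set H := multiplier lam m g h with hH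
  have hHm : Measurable H := measurable_multiplier lam m hg.measurable h
  have hgm := hg.measurable
  rw [hg.integral_withDensity]
  have s1 : ∫ η in Set.Ioi 0, (g η : ℂ) * kernelL (kernelK lam m) g 0 h x₀ (x * η) =
      (1 / (2 * Real.pi * x₀) : ℂ) * ∫ η in Set.Ioi 0, ∫ ω : ℝ, (g η : ℂ) *
        (Complex.exp ((ω * Real.log (x₀ / (x * η)) : ℝ) * Complex.I) * H ω) := by
    rw [← integral_const_mul]
    refine setIntegral_congr_fun measurableSet_Ioi fun η hη => ?_
    have hη : 0 < η := hη
    rw [kernelL_eq hlam m g h hx₀, if_pos (by positivity), integral_const_mul]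
    ring
  -- The exponential is unimodular, so the product g(η)‖H(ω)‖ dominates.
  have s2 : Integrable (Function.uncurry fun (η ω : ℝ) => (g η : ℂ) *
      (Complex.exp ((ω * Real.log (x₀ / (x * η)) : ℝ) * Complex.I) * H ω))
      ((volume.restrict (Set.Ioi 0)).prod volume) := by
    have hb : Integrable (fun p : ℝ × ℝ => g p.1 * ‖H p.2‖)
        ((volume.restrict (Set.Ioi 0)).prod volume) :=
      hg.integrable.restrict.mul_prod hi.norm
    refine hb.mono' ?_ (Eventually.of_forall fun p => ?_)
    · unfold Function.uncurry
      exact Measurable.aestronglyMeasurable (by fun_prop)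
    · rw [Function.uncurry, norm_mul, norm_mul, Complex.norm_exp_ofReal_mul_I, Complex.norm_real,
        Real.norm_of_nonneg (hg.nonneg _), one_mul]
  have s3 : ∀ ω : ℝ, ∫ η in Set.Ioi 0, (g η : ℂ) *
      (Complex.exp ((ω * Real.log (x₀ / (x * η)) : ℝ) * Complex.I) * H ω) =
      ∑ j ∈ Finset.Icc 1 (m + 1), (weight m j : ℂ) * ((wHat lam (j * h * ω) : ℂ) *
        Complex.exp ((ω * Real.log (x₀ / x) : ℝ) * Complex.I)) := fun ω => by
    have : ∫ η in Set.Ioi 0, (g η : ℂ) *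
        (Complex.exp ((ω * Real.log (x₀ / (x * η)) : ℝ) * Complex.I) * H ω) =
        Complex.exp ((ω * Real.log (x₀ / x) : ℝ) * Complex.I) * H ω
          * mellinR g (1 - ω * Complex.I) := by
      rw [mellinR, mellin, ← integral_const_mul]
      refine setIntegral_congr_fun measurableSet_Ioi fun η hη => ?_
      rw [exp_log_mul_eq_cpow hx₀ hx hη, smul_eq_mul]
      ring
    rw [this, hH, multiplier, mul_assoc, div_mul_cancel₀ _ (hne ω), kHat, Complex.ofReal_sum,
      Finset.mul_sum]
    refine Finset.sum_congr rfl fun j _ => ?_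
    rw [show (j : ℝ) * (ω * h) = j * h * ω by ring]
    push_cast
    ring
  rw [s1, integral_integral_swap s2]
  simp only [s3]
  have hjh : ∀ j ∈ Finset.Icc 1 (m + 1), 0 < (j : ℝ) * h := fun j hj => by
    have : (1 : ℝ) ≤ j := by exact_mod_cast (Finset.mem_Icc.mp hj).1
    positivity
  rw [integral_finsetSum]
  · rw [smoothed, Complex.ofReal_mul, Complex.ofReal_sum, Finset.mul_sum, Finset.mul_sum]
    refine Finset.sum_congr rfl fun j hj => ?_
    rw [integral_const_mul, integral_wHat_mul_exp hlam (hjh j hj)]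
    have : (Real.pi : ℂ) ≠ 0 := by exact_mod_cast Real.pi_ne_zero
    have : (x₀ : ℂ) ≠ 0 := by exact_mod_cast hx₀.ne'
    push_cast
    field_simp
  · intro j hj
    refine Integrable.const_mul ?_ _
    have := ((integrable_wHat hlam).comp_mul_left' (hjh j hj).ne').ofReal (𝕜 := ℂ)
    exact this.mul_bdd (c := 1) (by fun_prop)
      (Eventually.of_forall fun ω => by rw [Complex.norm_exp_ofReal_mul_I])

theorem integral_kernelL_lawY {lam : ℕ} (hlam : 1 ≤ lam) (m : ℕ) {f g : ℝ → ℝ}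
    (hf : IsDensityOnNonneg f) (hg : IsDensityOnNonneg g) {h : ℝ} (hh : 0 < h)
    (hi : Integrable (multiplier lam m g h))
    (hne : ∀ ω : ℝ, mellinR g (1 - ω * Complex.I) ≠ 0) {x₀ : ℝ} (hx₀ : 0 < x₀) :
    ∫ y, kernelL (kernelK lam m) g 0 h x₀ y ∂(lawY f g) =
      ((∫ x in Set.Ioi 0, f x * smoothed lam m h x₀ x : ℝ) : ℂ) := by
  have := hf.isProbabilityMeasure
  have := hg.isProbabilityMeasure
  have hm := measurable_kernelL hlam m hg.measurable h hx₀
  rw [lawY, integral_map (by fun_prop) hm.aestronglyMeasurable, integral_prod]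
  · rw [hf.integral_withDensity, ← integral_complex_ofReal]
    refine setIntegral_congr_fun measurableSet_Ioi fun x hx => ?_
    rw [integral_kernelL_mul hlam m hg hh hi hne hx₀ hx]
    push_cast
    rfl
  · refine Integrable.of_bound (C := (2 * Real.pi * x₀)⁻¹ * ∫ ω, ‖multiplier lam m g h ω‖) ?_
      (Eventually.of_forall fun p => norm_kernelL_le hlam m g h hx₀ _)
    exact (hm.comp (by fun_prop)).aestronglyMeasurable

/-! ### Taylor expansion in the Hölder class -/

/-- Induction on l: the derivative of the Taylor remainder of D 0 is the remainder of D 1, and the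
mean value inequality adds one factor |x - x₀|. A sequence D, rather than iterated derivatives, lets
the induction hypothesis apply to the shifted sequence. -/
theorem abs_sub_taylor_le {I : Set ℝ} (hI : I.OrdConnected) {x₀ A α : ℝ} (hx₀ : x₀ ∈ I)
    (hA : 0 ≤ A) (hα : 0 < α) (l : ℕ) (D : ℕ → ℝ → ℝ)
    (hD : ∀ k < l, ∀ x ∈ I, HasDerivWithinAt (D k) (D (k + 1) x) I x)
    (hl : ∀ x ∈ I, |D l x - D l x₀| ≤ A * |x - x₀| ^ α) :
    ∀ x ∈ I, |D 0 x - ∑ i ∈ Finset.range (l + 1), D i x₀ / i.factorial * (x - x₀) ^ i| ≤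
      A * |x - x₀| ^ (l + α) := by
  induction l generalizing D with
  | zero => simpa using hl
  | succ l ih =>
    intro x hx
    have ih := ih (fun k => D (k + 1)) (fun k hk => hD (k + 1) (by omega)) hl
    have hsub : Set.uIcc x₀ x ⊆ I := hI.uIcc_subset hx₀ hx
    have hder : ∀ y ∈ Set.uIcc x₀ x, HasDerivWithinAt
        (fun y => D 0 y - ∑ i ∈ Finset.range (l + 1 + 1), D i x₀ / i.factorial * (y - x₀) ^ i)
        (D 1 y - ∑ i ∈ Finset.range (l + 1), D (i + 1) x₀ / i.factorial * (y - x₀) ^ i)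
        (Set.uIcc x₀ x) y := by
      intro y hy
      refine ((hD 0 (by omega) y (hsub hy)).mono hsub).sub (HasDerivAt.hasDerivWithinAt ?_)
      simp only [Finset.sum_range_succ' _ (l + 1)]
      simp only [pow_zero, Nat.factorial_zero]
      refine HasDerivAt.add_const _ (HasDerivAt.fun_sum fun i _ => ?_)
      have := (((hasDerivAt_id y).sub_const x₀).pow (i + 1)).const_mul
        (D (i + 1) x₀ / (i + 1).factorial)
      convert! this using 1
      rw [Nat.factorial_succ]
      have : (i.factorial : ℝ) ≠ 0 := by positivity
      push_cast
      field_simp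
      simp
    have hb : ∀ y ∈ Set.uIcc x₀ x,
        ‖D 1 y - ∑ i ∈ Finset.range (l + 1), D (i + 1) x₀ / i.factorial * (y - x₀) ^ i‖ ≤
        A * |x - x₀| ^ (l + α) := fun y hy => by
      refine (ih y (hsub hy)).trans ?_
      have := Set.abs_sub_left_of_mem_uIcc hy
      gcongr
    have := (convex_uIcc x₀ x).norm_image_sub_le_of_norm_hasDerivWithin_le hder hb
      Set.left_mem_uIcc Set.right_mem_uIcc
    have h0 : D 0 x₀ - ∑ i ∈ Finset.range (l + 1 + 1), D i x₀ / i.factorial * (x₀ - x₀) ^ i = 0 := by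
      rw [Finset.sum_range_succ']
      simp
    rw [h0, sub_zero, Real.norm_eq_abs, Real.norm_eq_abs, mul_assoc] at this
    refine this.trans_eq ?_
    rcases (abs_nonneg (x - x₀)).eq_or_lt with h | h
    · rw [← h, mul_zero, Real.zero_rpow (by positivity)]
    · rw [show ((l + 1 : ℕ) : ℝ) + α = l + α + 1 by push_cast; ring, Real.rpow_add_one h.ne']

theorem HolderClass.exists_taylor {x₀ r A β : ℝ} {f : ℝ → ℝ} (hf : HolderClass x₀ r A β f)
    (hx₀ : 0 < x₀) (hr : 1 < r) (hA : 0 < A) (hβ : 0 < β) :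
    ∃ b : ℕ → ℝ, b 0 = f x₀ ∧ (∀ i, 1 ≤ i → i ≤ strictFloor β → |b i| ≤ A) ∧
      ∀ x ∈ Set.Icc (x₀ / r) (r * x₀),
        |f x - ∑ i ∈ Finset.range (strictFloor β + 1), b i * (x - x₀) ^ i| ≤ A * |x - x₀| ^ β := by
  set l := strictFloor β
  set I := Set.Icc (x₀ / r) (r * x₀) with hI
  have h1 : x₀ / r < x₀ := div_lt_self hx₀ hr
  have h2 : x₀ < r * x₀ := by nlinarith
  have hmem : x₀ ∈ I := ⟨h1.le, h2.le⟩
  have hU : UniqueDiffOn ℝ I := uniqueDiffOn_Icc (h1.trans h2)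
  have hlt : (l : ℝ) < β := (isGreatest_strictFloor hβ).1
  refine ⟨fun i => iteratedDerivWithin i f I x₀ / i.factorial, by simp, fun i hi hil => ?_, ?_⟩
  · rw [abs_div, Nat.abs_cast]
    have h3 := hf.deriv_le i hi hil x₀ hmem
    have h4 : (1 : ℝ) ≤ i.factorial := by exact_mod_cast Nat.one_le_iff_ne_zero.mpr i.factorial_ne_zero
    rw [div_le_iff₀ (by positivity)]
    nlinarith
  · have key := abs_sub_taylor_le (Set.ordConnected_Icc) hmem hA.le (sub_pos.mpr hlt) l
      (fun k => iteratedDerivWithin k f I) ?_ (fun x hx => hf.holder x hx x₀ hmem)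
    · intro x hx
      have := key x hx
      simpa using this
    · intro k hk x hx
      rw [iteratedDerivWithin_succ]
      exact (hf.contDiffOn.differentiableOn_iteratedDerivWithin (by exact_mod_cast hk) hU
        x hx).hasDerivWithinAt

/-- The class bounds derivatives but not f itself. By Taylor expansion f exceeds f(x₀) - M₀
throughout the interval, where a density has mass at most 1. The bound depends on r, so it may enter
lower-order terms only. -/
theorem HolderClass.exists_bound {x₀ r A β : ℝ} (hx₀ : 0 < x₀) (hr : 1 < r) (hA : 0 < A)
    (hβ : 0 < β) : ∃ M : ℝ, 0 ≤ M ∧ ∀ f : ℝ → ℝ, HolderClass x₀ r A β f → f x₀ ≤ M := by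
  set l := strictFloor β
  have h1 : x₀ / r < x₀ := div_lt_self hx₀ hr
  have h2 : x₀ < r * x₀ := by nlinarith
  set d := r * x₀ - x₀ / r with hd
  have hd0 : 0 < d := by linarith
  set M₀ := ∑ i ∈ Finset.range l, A * d ^ (i + 1) + A * d ^ β
  refine ⟨M₀ + 1 / d, by positivity, fun f hf => ?_⟩
  obtain ⟨b, hb0, hb, hT⟩ := hf.exists_taylor hx₀ hr hA hβ
  have hlow : ∀ x ∈ Set.Icc (x₀ / r) (r * x₀), f x₀ - M₀ ≤ f x := fun x hx => by
    have hxd : |x - x₀| ≤ d := abs_le.mpr ⟨by linarith [hx.1], by linarith [hx.2]⟩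
    have h3 := hT x hx
    rw [Finset.sum_range_succ', hb0, pow_zero, mul_one] at h3
    have h4 : |∑ i ∈ Finset.range l, b (i + 1) * (x - x₀) ^ (i + 1)| ≤
        ∑ i ∈ Finset.range l, A * d ^ (i + 1) := by
      refine (Finset.abs_sum_le_sum_abs _ _).trans (Finset.sum_le_sum fun i hi => ?_)
      rw [abs_mul, abs_pow]
      have := hb (i + 1) (by omega) (by have := Finset.mem_range.mp hi; omega)
      gcongr
    have h5 : A * |x - x₀| ^ β ≤ A * d ^ β := by gcongr
    have := (abs_le.mp h3).1
    have := (abs_le.mp h4).1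
    simp only [M₀]
    linarith
  have h6 : ∫ x in Set.Icc (x₀ / r) (r * x₀), (f x₀ - M₀) ≤ 1 := by
    rw [← hf.density.integral_eq_one]
    refine (setIntegral_mono_on (by simp) hf.density.integrable.integrableOn measurableSet_Icc
      hlow).trans ?_
    exact setIntegral_le_integral hf.density.integrable (Eventually.of_forall hf.density.nonneg)
  rw [setIntegral_const, smul_eq_mul, Real.volume_real_Icc_of_le (by linarith)] at h6
  rw [← sub_le_iff_le_add', le_div_iff₀ hd0]
  linarith

/-! ### Finite differences -/

/-- The function whose dilates are averaged by the estimator. -/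
noncomputable def tilted (f : ℝ → ℝ) (x₀ v : ℝ) : ℝ := Real.exp (-v) * f (x₀ * Real.exp (-v))

theorem abs_one_sub_exp_le {s c : ℝ} (h : |s| ≤ c) : |1 - Real.exp s| ≤ |s| * Real.exp c := by
  have h1 : 1 - Real.exp s ≤ |s| := by
    have := Real.add_one_le_exp s
    have := neg_abs_le s
    linarith
  have h2 : Real.exp s - 1 ≤ |s| * Real.exp c := by
    have h3 := Real.add_one_le_exp (-s)
    have h4 : Real.exp s * Real.exp (-s) = 1 := by rw [← Real.exp_add]; simp
    have h5 : Real.exp s - 1 ≤ s * Real.exp s := by nlinarith [Real.exp_pos s]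
    refine h5.trans ?_
    exact mul_le_mul (le_abs_self s) (Real.exp_le_exp.mpr ((le_abs_self s).trans h))
      (Real.exp_pos s).le (abs_nonneg s)
  have h6 : |s| ≤ |s| * Real.exp c :=
    le_mul_of_one_le_right (abs_nonneg s) (Real.one_le_exp ((abs_nonneg s).trans h))
  rw [abs_le]
  constructor <;> linarith

/-- Expanding (q^j - 1)^i leaves sums to which `sum_weight_mul_pow` applies at q^(k+1). The term 0^i
is the same expansion at q = 1, so the constant parts cancel. -/
theorem sum_weight_mul_pow_sub (m i : ℕ) (q : ℝ) :
    ∑ j ∈ Finset.Icc 1 (m + 1), weight m j * (q ^ j * (q ^ j - 1) ^ i) - 0 ^ i =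
      -∑ k ∈ Finset.range (i + 1), (-1) ^ (i - k) * (i.choose k : ℝ) * (1 - q ^ (k + 1)) ^ (m + 1) := by
  have e : ∀ y : ℝ, (y - 1) ^ i = ∑ k ∈ Finset.range (i + 1), (-1) ^ (i - k) * (i.choose k : ℝ) * y ^ k :=
    fun y => by
      rw [sub_eq_add_neg, add_pow]
      exact Finset.sum_congr rfl fun k _ => by ring
  have e1 : ∀ j, weight m j * (q ^ j * (q ^ j - 1) ^ i) = ∑ k ∈ Finset.range (i + 1),
      (-1) ^ (i - k) * (i.choose k : ℝ) * (weight m j * (q ^ (k + 1)) ^ j) := fun j => by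
    rw [e, Finset.mul_sum, Finset.mul_sum]
    refine Finset.sum_congr rfl fun k _ => ?_
    rw [← pow_mul, ← pow_mul]
    ring
  have e2 : (0 : ℝ) ^ i = ∑ k ∈ Finset.range (i + 1), (-1) ^ (i - k) * (i.choose k : ℝ) := by
    simpa using e 1
  simp only [e1]
  rw [Finset.sum_comm, e2, ← Finset.sum_sub_distrib, ← Finset.sum_neg_distrib]
  refine Finset.sum_congr rfl fun k _ => ?_
  rw [← Finset.mul_sum, sum_weight_mul_pow]
  ring

theorem abs_sum_weight_mul_exp_le (m i : ℕ) {v : ℝ} (hv : |v| ≤ 1) :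
    |∑ j ∈ Finset.Icc 1 (m + 1), weight m j *
        (Real.exp (-v) ^ j * (Real.exp (-v) ^ j - 1) ^ i) - 0 ^ i| ≤
      2 ^ i * ((i + 1) * Real.exp (i + 1)) ^ (m + 1) * |v| ^ (m + 1) := by
  rw [sum_weight_mul_pow_sub, abs_neg]
  calc _ ≤ ∑ k ∈ Finset.range (i + 1), (i.choose k : ℝ) *
        (((i + 1) * Real.exp (i + 1)) ^ (m + 1) * |v| ^ (m + 1)) := by
        refine (Finset.abs_sum_le_sum_abs _ _).trans (Finset.sum_le_sum fun k hk => ?_)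
        rw [abs_mul, abs_mul, abs_pow, abs_neg, abs_one, one_pow, one_mul, Nat.abs_cast, abs_pow,
          ← mul_pow]
        have hk' : (k : ℝ) + 1 ≤ i + 1 := by exact_mod_cast Finset.mem_range.mp hk
        have hs : |((k + 1 : ℕ) : ℝ) * -v| ≤ (i + 1) * |v| := by
          rw [abs_mul, abs_neg, Nat.abs_cast]
          push_cast
          gcongr
        have hs' : |((k + 1 : ℕ) : ℝ) * -v| ≤ i + 1 :=
          hs.trans (mul_le_of_le_one_right (by positivity) hv)
        rw [← Real.exp_nat_mul]
        have := abs_one_sub_exp_le hs'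
        gcongr
        calc _ ≤ _ := this
          _ ≤ (i + 1) * |v| * Real.exp (i + 1) := by gcongr
          _ = _ := by ring
    _ = _ := by
        rw [← Finset.sum_mul]
        have := Nat.sum_range_choose i
        rw [← Nat.cast_sum, this]
        push_cast
        ring

theorem mul_exp_mem_Icc {x₀ r s : ℝ} (hx₀ : 0 < x₀) (hr : 1 < r) (hs : |s| ≤ Real.log r) :
    x₀ * Real.exp s ∈ Set.Icc (x₀ / r) (r * x₀) := by
  have hr0 : 0 < r := by linarith
  obtain ⟨h1, h2⟩ := abs_le.mp hs
  have h3 := Real.exp_le_exp.mpr h1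
  have h4 := Real.exp_le_exp.mpr h2
  rw [Real.exp_neg, Real.exp_log hr0] at h3
  rw [Real.exp_log hr0] at h4
  constructor
  · rw [div_eq_mul_inv]; gcongr
  · rw [mul_comm r]; gcongr

/-- The coefficient of |v|^β is explicit because it reaches the final constant, while C may depend
on x₀, r and A since it multiplies a higher power. The condition on v keeps every x₀e^(-jv) inside
the interval. The factor 3 bounds e, the inner 2 comes from |e^s - 1| ≤ 2|s|, and 2^(m+1) from the
weights. -/
theorem HolderClass.exists_difference_bound (β : ℝ) (hβ : 0 < β) (m : ℕ) {x₀ r A : ℝ}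
    (hx₀ : 0 < x₀) (hr : 1 < r) (hA : 0 < A) :
    ∃ C : ℝ, 0 ≤ C ∧ ∀ f : ℝ → ℝ, HolderClass x₀ r A β f → ∀ v : ℝ,
      (m + 1) * |v| ≤ min 1 (Real.log r) →
      |∑ j ∈ Finset.Icc 1 (m + 1), weight m j * tilted f x₀ (j * v) - f x₀| ≤
        C * |v| ^ (m + 1) + 2 ^ (m + 1) * 3 * (2 * (m + 1)) ^ β * (A * x₀ ^ β) * |v| ^ β := by
  obtain ⟨M, hM, hbd⟩ := HolderClass.exists_bound hx₀ hr hA hβ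
  set l := strictFloor β
  refine ⟨∑ i ∈ Finset.range (l + 1), (M + A) * x₀ ^ i *
    (2 ^ i * ((i + 1) * Real.exp (i + 1)) ^ (m + 1)), by positivity, fun f hf v hv => ?_⟩
  obtain ⟨b, hb0, hb, hT⟩ := hf.exists_taylor hx₀ hr hA hβ
  have hbM : ∀ i ∈ Finset.range (l + 1), |b i| ≤ M + A := fun i hi => by
    rcases Nat.eq_zero_or_pos i with rfl | hi0
    · rw [hb0, abs_of_nonneg (hf.density.nonneg _)]
      linarith [hbd f hf]
    · linarith [hb i hi0 (by have := Finset.mem_range.mp hi; omega)]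
  set q := Real.exp (-v) with hq
  have hjv : ∀ j ∈ Finset.Icc 1 (m + 1), |-(j * v)| ≤ (m + 1) * |v| := fun j hj => by
    have : (j : ℝ) ≤ m + 1 := by exact_mod_cast (Finset.mem_Icc.mp hj).2
    rw [abs_neg, abs_mul, Nat.abs_cast]
    gcongr
  have hv1 : |v| ≤ 1 := by
    have h1 := hv.trans (min_le_left _ _)
    have h2 : (0 : ℝ) ≤ m * |v| := by positivity
    linarith
  have hqj : ∀ j : ℕ, Real.exp (-(j * v)) = q ^ j := fun j => by
    rw [hq, ← Real.exp_nat_mul]; congr 1; ring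
  set R : ℕ → ℝ := fun j => f (x₀ * q ^ j) -
    ∑ i ∈ Finset.range (l + 1), b i * (x₀ * q ^ j - x₀) ^ i with hR
  have hRb : ∀ j ∈ Finset.Icc 1 (m + 1), |q ^ j * R j| ≤
      3 * (2 * (m + 1)) ^ β * (A * x₀ ^ β) * |v| ^ β := fun j hj => by
    have h1 := (hjv j hj).trans (hv.trans (min_le_left _ _))
    have h2 := (hjv j hj).trans (hv.trans (min_le_right _ _))
    have h3 : q ^ j ≤ 3 := by
      rw [← hqj]
      have := Real.exp_le_exp.mpr ((le_abs_self _).trans h1)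
      linarith [Real.exp_one_lt_d9]
    have h4 := hT _ (mul_exp_mem_Icc hx₀ hr h2)
    rw [hqj] at h4
    have h5 : |x₀ * q ^ j - x₀| ≤ x₀ * (2 * (m + 1) * |v|) := by
      rw [show x₀ * q ^ j - x₀ = x₀ * (q ^ j - 1) by ring, abs_mul, abs_of_pos hx₀, ← hqj]
      have := Real.abs_exp_sub_one_le h1
      have := hjv j hj
      gcongr
      linarith
    have h6 : |x₀ * q ^ j - x₀| ^ β ≤ x₀ ^ β * ((2 * (m + 1)) ^ β * |v| ^ β) := by
      rw [← Real.mul_rpow (by positivity) (abs_nonneg v), ← Real.mul_rpow hx₀.le (by positivity)]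
      gcongr
    have hq0 : 0 ≤ q ^ j := by positivity
    rw [abs_mul, abs_of_nonneg hq0]
    calc q ^ j * |R j| ≤ 3 * (A * (x₀ ^ β * ((2 * (m + 1)) ^ β * |v| ^ β))) := by
          gcongr
          exact h4.trans (by gcongr)
      _ = _ := by ring
  have hsplit : ∑ j ∈ Finset.Icc 1 (m + 1), weight m j * tilted f x₀ (j * v) - f x₀ =
      ∑ i ∈ Finset.range (l + 1), b i * x₀ ^ i * (∑ j ∈ Finset.Icc 1 (m + 1), weight m j *
        (q ^ j * (q ^ j - 1) ^ i) - 0 ^ i)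
      + ∑ j ∈ Finset.Icc 1 (m + 1), weight m j * (q ^ j * R j) := by
    have e1 : ∀ j, weight m j * tilted f x₀ (j * v) = ∑ i ∈ Finset.range (l + 1),
        b i * x₀ ^ i * (weight m j * (q ^ j * (q ^ j - 1) ^ i)) + weight m j * (q ^ j * R j) :=
      fun j => by
        have : ∀ i, b i * x₀ ^ i * (weight m j * (q ^ j * (q ^ j - 1) ^ i)) =
            weight m j * q ^ j * (b i * (x₀ * q ^ j - x₀) ^ i) := fun i => by
          rw [show x₀ * q ^ j - x₀ = x₀ * (q ^ j - 1) by ring, mul_pow]; ring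
        simp only [this]
        rw [← Finset.mul_sum, tilted, hqj, hR]
        ring
    -- Here 0^0 = 1 selects the constant coefficient.
    have e2 : f x₀ = ∑ i ∈ Finset.range (l + 1), b i * x₀ ^ i * 0 ^ i := by
      rw [Finset.sum_range_succ', ← hb0]
      simp
    rw [e2]
    simp only [e1, mul_sub]
    rw [Finset.sum_add_distrib, Finset.sum_comm, Finset.sum_sub_distrib]
    simp only [Finset.mul_sum]
    ring
  rw [hsplit]
  refine (abs_add_le _ _).trans (add_le_add ?_ ?_)
  · rw [Finset.sum_mul]
    refine (Finset.abs_sum_le_sum_abs _ _).trans (Finset.sum_le_sum fun i hi => ?_)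
    rw [abs_mul, abs_mul, abs_of_pos (pow_pos hx₀ i), mul_assoc _ _ (|v| ^ (m + 1))]
    have := hbM i hi
    have := abs_sum_weight_mul_exp_le m i hv1
    gcongr
  · calc _ ≤ ∑ j ∈ Finset.Icc 1 (m + 1), |weight m j| *
          (3 * (2 * (m + 1)) ^ β * (A * x₀ ^ β) * |v| ^ β) := by
          refine (Finset.abs_sum_le_sum_abs _ _).trans (Finset.sum_le_sum fun j hj => ?_)
          rw [abs_mul]
          exact mul_le_mul_of_nonneg_left (hRb j hj) (abs_nonneg _)
      _ ≤ 2 ^ (m + 1) * (3 * (2 * (m + 1)) ^ β * (A * x₀ ^ β) * |v| ^ β) := by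
          rw [← Finset.sum_mul]
          exact mul_le_mul_of_nonneg_right (sum_abs_weight_le m) (by positivity)
      _ = _ := by ring

/-! ### The bias -/

theorem integrable_abs_w_mul_rpow {lam : ℕ} (hlam : 1 ≤ lam) {β : ℝ} (hβ : 0 < β) :
    Integrable fun t : ℝ => |w lam t| * |t| ^ β := by
  obtain ⟨k, hk⟩ := exists_nat_ge β
  refine ((integrable_abs_w_mul_pow hlam 0).add (integrable_abs_w_mul_pow hlam k)).mono'
    ((integrable_w hlam).abs.aestronglyMeasurable.mul
      (measurable_norm.pow_const β : Measurable fun t : ℝ => |t| ^ β).aestronglyMeasurable)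
    (Eventually.of_forall fun t => ?_)
  rw [Real.norm_of_nonneg (by positivity), Pi.add_apply, ← mul_add]
  refine mul_le_mul_of_nonneg_left ?_ (abs_nonneg _)
  rw [pow_zero]
  rcases le_total |t| 1 with h | h
  · have := Real.rpow_le_one (abs_nonneg t) h hβ.le
    have : 0 ≤ |t| ^ k := by positivity
    linarith
  · have := Real.rpow_le_rpow_of_exponent_le h hk
    rw [Real.rpow_natCast] at this
    linarith

theorem image_mul_exp_neg {x₀ a : ℝ} (hx₀ : 0 < x₀) (ha : 0 < a) :
    (fun u : ℝ => x₀ * Real.exp (-(a * u))) '' Set.univ = Set.Ioi 0 := by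
  rw [Set.image_univ]
  ext x
  constructor
  · rintro ⟨u, rfl⟩
    exact mul_pos hx₀ (Real.exp_pos _)
  · intro hx
    have hx : 0 < x := hx
    refine ⟨-(Real.log (x / x₀) / a), ?_⟩
    have : -(a * -(Real.log (x / x₀) / a)) = Real.log (x / x₀) := by field_simp
    simp only
    rw [this, Real.exp_log (by positivity)]
    field_simp

theorem hasDerivAt_mul_exp_neg (x₀ a u : ℝ) :
    HasDerivAt (fun u : ℝ => x₀ * Real.exp (-(a * u))) (-(x₀ * a * Real.exp (-(a * u)))) u := by
  have := ((((hasDerivAt_id u).const_mul a).neg).exp).const_mul x₀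
  convert! this using 1
  simp
  ring

theorem injective_mul_exp_neg {x₀ a : ℝ} (hx₀ : 0 < x₀) (ha : 0 < a) :
    Set.InjOn (fun u : ℝ => x₀ * Real.exp (-(a * u))) Set.univ := by
  intro u _ v _ h
  have := Real.exp_injective (mul_left_cancel₀ hx₀.ne' h)
  exact mul_left_cancel₀ ha.ne' (neg_injective this)

theorem integral_Ioi_eq_integral_exp {x₀ a : ℝ} (hx₀ : 0 < x₀) (ha : 0 < a) (ψ : ℝ → ℝ) :
    ∫ x in Set.Ioi 0, ψ x =
      ∫ u : ℝ, x₀ * a * Real.exp (-(a * u)) * ψ (x₀ * Real.exp (-(a * u))) := by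
  rw [← image_mul_exp_neg hx₀ ha, integral_image_eq_integral_abs_deriv_smul MeasurableSet.univ
    (fun u _ => (hasDerivAt_mul_exp_neg x₀ a u).hasDerivWithinAt) (injective_mul_exp_neg hx₀ ha),
    setIntegral_univ]
  refine integral_congr_ae (Eventually.of_forall fun u => ?_)
  simp only [smul_eq_mul]
  rw [abs_neg, abs_of_pos (by positivity)]

theorem integrableOn_Ioi_iff_integrable_exp {x₀ a : ℝ} (hx₀ : 0 < x₀) (ha : 0 < a) (ψ : ℝ → ℝ) :
    IntegrableOn ψ (Set.Ioi 0) ↔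
      Integrable fun u : ℝ => x₀ * a * Real.exp (-(a * u)) * ψ (x₀ * Real.exp (-(a * u))) := by
  rw [← image_mul_exp_neg hx₀ ha, integrableOn_image_iff_integrableOn_abs_deriv_smul
    MeasurableSet.univ (fun u _ => (hasDerivAt_mul_exp_neg x₀ a u).hasDerivWithinAt)
    (injective_mul_exp_neg hx₀ ha), integrableOn_univ]
  refine integrable_congr (Eventually.of_forall fun u => ?_)
  simp only [smul_eq_mul]
  rw [abs_neg, abs_of_pos (by positivity)]

theorem IsDensityOnNonneg.integrable_tilted {f : ℝ → ℝ} (hf : IsDensityOnNonneg f) {x₀ a : ℝ}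
    (hx₀ : 0 < x₀) (ha : 0 < a) : Integrable fun u : ℝ => tilted f x₀ (a * u) := by
  have := (((integrableOn_Ioi_iff_integrable_exp hx₀ ha f).mp hf.integrable.integrableOn).const_mul
    (x₀ * a)⁻¹)
  refine this.congr (Eventually.of_forall fun u => ?_)
  simp only [tilted]
  field_simp

/-- Total mass is the only control on f away from x₀; in the variable u it becomes 1/(x₀a). -/
theorem IsDensityOnNonneg.integral_tilted {f : ℝ → ℝ} (hf : IsDensityOnNonneg f) {x₀ a : ℝ}
    (hx₀ : 0 < x₀) (ha : 0 < a) : ∫ u : ℝ, tilted f x₀ (a * u) = (x₀ * a)⁻¹ := by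
  have h1 : ∫ x in Set.Ioi 0, f x = 1 := by
    rw [← integral_Ici_eq_integral_Ioi, setIntegral_eq_integral_of_forall_compl_eq_zero,
      hf.integral_eq_one]
    exact fun x hx => hf.support_nonneg x (by simpa using hx)
  rw [integral_Ioi_eq_integral_exp hx₀ ha] at h1
  have h2 : (x₀ * a) * ∫ u : ℝ, tilted f x₀ (a * u) = 1 := by
    rw [← h1, ← integral_const_mul]
    refine integral_congr_ae (Eventually.of_forall fun u => ?_)
    simp only [tilted]
    ring
  exact eq_inv_of_mul_eq_one_right h2

theorem tilted_nonneg {f : ℝ → ℝ} (hf : IsDensityOnNonneg f) (x₀ v : ℝ) : 0 ≤ tilted f x₀ v :=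
  mul_nonneg (Real.exp_pos _).le (hf.nonneg _)

theorem integrable_w_mul_tilted {lam : ℕ} (hlam : 1 ≤ lam) {f : ℝ → ℝ} (hf : IsDensityOnNonneg f)
    {x₀ a : ℝ} (hx₀ : 0 < x₀) (ha : 0 < a) :
    Integrable fun u : ℝ => w lam u * tilted f x₀ (a * u) := by
  obtain ⟨W, -, hW⟩ := exists_abs_w_mul_pow_le hlam 0
  exact (hf.integrable_tilted hx₀ ha).bdd_mul (c := W) (integrable_w hlam).aestronglyMeasurable
    (Eventually.of_forall fun u => by simpa using hW u)

/-- Substituting x = x₀e^(-jhu) in the j-th term moves the dilation from w to f, so one factor w(u)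
serves all terms; ∫ w = 1 brings f(x₀) under the integral. -/
theorem integral_mul_smoothed {lam : ℕ} (hlam : 1 ≤ lam) (m : ℕ) {f : ℝ → ℝ}
    (hf : IsDensityOnNonneg f) {h x₀ : ℝ} (hh : 0 < h) (hx₀ : 0 < x₀) :
    (∫ x in Set.Ioi 0, f x * smoothed lam m h x₀ x) - f x₀ =
      ∫ u : ℝ, w lam u *
        (∑ j ∈ Finset.Icc 1 (m + 1), weight m j * tilted f x₀ (j * (h * u)) - f x₀) := by
  have hjh : ∀ j ∈ Finset.Icc 1 (m + 1), 0 < (j : ℝ) * h := fun j hj => by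
    have : (1 : ℝ) ≤ j := by exact_mod_cast (Finset.mem_Icc.mp hj).1
    positivity
  have key : ∀ a : ℝ, 0 < a → ∀ u : ℝ,
      x₀ * a * Real.exp (-(a * u)) * (f (x₀ * Real.exp (-(a * u))) *
        (x₀⁻¹ * (a⁻¹ * w lam (Real.log (x₀ / (x₀ * Real.exp (-(a * u)))) / a)))) =
      w lam u * tilted f x₀ (a * u) := fun a ha u => by
    have : Real.log (x₀ / (x₀ * Real.exp (-(a * u)))) / a = u := by
      rw [← div_div, div_self hx₀.ne', one_div, ← Real.exp_neg, neg_neg, Real.log_exp]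
      field_simp
    rw [this, tilted]
    field_simp
  have hI : ∀ j ∈ Finset.Icc 1 (m + 1), IntegrableOn (fun x => f x *
      (x₀⁻¹ * (((j : ℝ) * h)⁻¹ * w lam (Real.log (x₀ / x) / (j * h))))) (Set.Ioi 0) := fun j hj => by
    rw [integrableOn_Ioi_iff_integrable_exp hx₀ (hjh j hj)]
    simp only [key _ (hjh j hj)]
    exact integrable_w_mul_tilted hlam hf hx₀ (hjh j hj)
  have hV : ∀ j ∈ Finset.Icc 1 (m + 1), ∫ x in Set.Ioi 0, f x *
      (x₀⁻¹ * (((j : ℝ) * h)⁻¹ * w lam (Real.log (x₀ / x) / (j * h)))) =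
      ∫ u, w lam u * tilted f x₀ (j * h * u) := fun j hj => by
    rw [integral_Ioi_eq_integral_exp hx₀ (hjh j hj)]
    simp only [key _ (hjh j hj)]
  have e1 : ∀ x, f x * smoothed lam m h x₀ x = ∑ j ∈ Finset.Icc 1 (m + 1), weight m j * (f x *
      (x₀⁻¹ * (((j : ℝ) * h)⁻¹ * w lam (Real.log (x₀ / x) / (j * h))))) := fun x => by
    rw [smoothed, Finset.mul_sum, Finset.mul_sum]
    exact Finset.sum_congr rfl fun j _ => by ring
  have e2 : ∀ u, w lam u *
      (∑ j ∈ Finset.Icc 1 (m + 1), weight m j * tilted f x₀ (j * (h * u)) - f x₀) =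
      ∑ j ∈ Finset.Icc 1 (m + 1), weight m j * (w lam u * tilted f x₀ (j * h * u))
        - f x₀ * w lam u := fun u => by
    rw [mul_sub, Finset.mul_sum, mul_comm (f x₀)]
    congr 1
    exact Finset.sum_congr rfl fun j _ => by rw [mul_assoc (j : ℝ)]; ring
  have hI' : ∀ j ∈ Finset.Icc 1 (m + 1),
      Integrable fun u => weight m j * (w lam u * tilted f x₀ (j * h * u)) := fun j hj =>
    (integrable_w_mul_tilted hlam hf hx₀ (hjh j hj)).const_mul _
  simp only [e1, e2]
  rw [integral_finsetSum _ fun j hj => (hI j hj).const_mul _,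
    integral_sub (integrable_finsetSum _ hI') ((integrable_w hlam).const_mul _),
    integral_finsetSum _ hI', integral_const_mul, integral_w hlam, mul_one]
  congr 1
  refine Finset.sum_congr rfl fun j hj => ?_
  rw [integral_const_mul, integral_const_mul, hV j hj]

/-- C is fixed before x₀, r and A, and C' after them: only C can reach the limiting constant. -/
theorem exists_bias_bound {lam : ℕ} (hlam : 1 ≤ lam) {β : ℝ} (hβ : 0 < β) (m : ℕ) :
    ∃ C : ℝ, 0 ≤ C ∧ ∀ x₀ r A : ℝ, 0 < x₀ → 1 < r → 0 < A →
      ∃ C' : ℝ, 0 ≤ C' ∧ ∀ f : ℝ → ℝ, HolderClass x₀ r A β f → ∀ h : ℝ, 0 < h →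
        |(∫ x in Set.Ioi 0, f x * smoothed lam m h x₀ x) - f x₀| ≤
          C * (A * x₀ ^ β) * h ^ β + C' * h ^ (m + 1) := by
  obtain ⟨W, hW0, hW⟩ := exists_abs_w_mul_pow_le hlam (m + 2)
  set J := ∫ u : ℝ, |w lam u| * |u| ^ (m + 1)
  set Jβ := ∫ u : ℝ, |w lam u| * |u| ^ β
  have hJ : 0 ≤ J := integral_nonneg fun _ => by positivity
  have hJβ : 0 ≤ Jβ := integral_nonneg fun _ => by positivity
  set B : ℝ := 2 ^ (m + 1) * 3 * (2 * (m + 1)) ^ β with hB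
  have hB0 : 0 ≤ B := by positivity
  refine ⟨B * Jβ, by positivity, fun x₀ r A hx₀ hr hA => ?_⟩
  obtain ⟨M, hM, hbd⟩ := HolderClass.exists_bound hx₀ hr hA hβ
  obtain ⟨C, hC, hdiff⟩ := HolderClass.exists_difference_bound β hβ m hx₀ hr hA
  set δ := min 1 (Real.log r) with hδ
  have hδ0 : 0 < δ := lt_min one_pos (Real.log_pos hr)
  set K : ℝ := (m + 1) / δ with hK
  have hK0 : 0 < K := by positivity
  -- The summands come from the polynomial part near x₀, from f(x₀) at large u, and from the tilted
  -- densities at large u.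
  refine ⟨C * J + M * K ^ (m + 1) * J + W * K ^ (m + 2) * (2 ^ (m + 1) * x₀⁻¹), by positivity,
    fun f hf h hh => ?_⟩
  have hfd := hf.density
  have hjh : ∀ j ∈ Finset.Icc 1 (m + 1), 1 ≤ (j : ℝ) := fun j hj => by
    exact_mod_cast (Finset.mem_Icc.mp hj).1
  set T : ℝ → ℝ := fun u => ∑ j ∈ Finset.Icc 1 (m + 1), |weight m j| * tilted f x₀ (j * h * u)
    with hT
  have hT0 : ∀ u, 0 ≤ T u := fun u => Finset.sum_nonneg fun j _ =>
    mul_nonneg (abs_nonneg _) (tilted_nonneg hfd _ _)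
  have hTi' : ∀ j ∈ Finset.Icc 1 (m + 1),
      Integrable fun u => |weight m j| * tilted f x₀ (j * h * u) := fun j hj =>
    (hfd.integrable_tilted hx₀ (by have := hjh j hj; positivity)).const_mul _
  have hTi : Integrable T := integrable_finsetSum _ hTi'
  have hTI : ∫ u, T u ≤ 2 ^ (m + 1) * x₀⁻¹ * h⁻¹ := by
    rw [hT, integral_finsetSum _ hTi']
    calc _ ≤ ∑ j ∈ Finset.Icc 1 (m + 1), |weight m j| * (x₀⁻¹ * h⁻¹) := by
          refine Finset.sum_le_sum fun j hj => ?_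
          have h1 := hjh j hj
          rw [integral_const_mul, hfd.integral_tilted hx₀ (by positivity), ← mul_inv]
          gcongr
          exact le_mul_of_one_le_left hh.le h1
      _ ≤ 2 ^ (m + 1) * (x₀⁻¹ * h⁻¹) := by
          rw [← Finset.sum_mul]
          exact mul_le_mul_of_nonneg_right (sum_abs_weight_le m) (by positivity)
      _ = _ := by ring
  rw [integral_mul_smoothed hlam m hfd hh hx₀]
  have hpt : ∀ u : ℝ, ‖w lam u *
      (∑ j ∈ Finset.Icc 1 (m + 1), weight m j * tilted f x₀ (j * (h * u)) - f x₀)‖ ≤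
      (C * h ^ (m + 1) + M * K ^ (m + 1) * h ^ (m + 1)) * (|w lam u| * |u| ^ (m + 1))
        + B * (A * x₀ ^ β) * h ^ β * (|w lam u| * |u| ^ β)
        + W * K ^ (m + 2) * h ^ (m + 2) * T u := fun u => by
    have n1 : 0 ≤ M * K ^ (m + 1) * h ^ (m + 1) * (|w lam u| * |u| ^ (m + 1)) := by positivity
    have n2 : 0 ≤ W * K ^ (m + 2) * h ^ (m + 2) * T u := mul_nonneg (by positivity) (hT0 u)
    have n3 : 0 ≤ C * h ^ (m + 1) * (|w lam u| * |u| ^ (m + 1)) := by positivity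
    have n4 : 0 ≤ B * (A * x₀ ^ β) * h ^ β * (|w lam u| * |u| ^ β) := by positivity
    rw [norm_mul, Real.norm_eq_abs, Real.norm_eq_abs]
    rcases le_or_gt ((m + 1) * |h * u|) δ with hu | hu
    · have h1 := mul_le_mul_of_nonneg_left (hdiff f hf (h * u) hu) (abs_nonneg (w lam u))
      rw [abs_mul, abs_of_pos hh, mul_pow, Real.mul_rpow hh.le (abs_nonneg u), ← hB] at h1
      refine h1.trans ?_
      rw [mul_add]
      linarith
    -- Outside the Taylor window powers of Kh|u| can be inserted freely, which trades decay of w for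
    -- powers of h.
    · have hKu : 1 ≤ K * h * |u| := by
        rw [abs_mul, abs_of_pos hh] at hu
        rw [hK, div_mul_eq_mul_div, div_mul_eq_mul_div, le_div_iff₀ hδ0]
        linarith
      have hfM : |f x₀| ≤ M := by
        rw [abs_of_nonneg (hfd.nonneg _)]; exact hbd f hf
      have h2 : |∑ j ∈ Finset.Icc 1 (m + 1), weight m j * tilted f x₀ (j * (h * u)) - f x₀| ≤
          T u + M := by
        refine (abs_sub _ _).trans (add_le_add ?_ hfM)
        refine (Finset.abs_sum_le_sum_abs _ _).trans_eq (Finset.sum_congr rfl fun j _ => ?_)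
        rw [abs_mul, abs_of_nonneg (tilted_nonneg hfd _ _), mul_assoc]
      -- One power more than m+1, because the integral of T costs a factor 1/h.
      have h3 : |w lam u| ≤ W * K ^ (m + 2) * h ^ (m + 2) := by
        calc |w lam u| ≤ |w lam u| * (K * h * |u|) ^ (m + 2) :=
              le_mul_of_one_le_right (abs_nonneg _) (one_le_pow₀ hKu)
          _ = (|w lam u| * |u| ^ (m + 2)) * (K ^ (m + 2) * h ^ (m + 2)) := by
              rw [mul_pow, mul_pow]; ring
          _ ≤ W * (K ^ (m + 2) * h ^ (m + 2)) := by
              have := hW u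
              gcongr
          _ = _ := by ring
      have h4 : |w lam u| * M ≤ M * K ^ (m + 1) * h ^ (m + 1) * (|w lam u| * |u| ^ (m + 1)) := by
        calc |w lam u| * M ≤ |w lam u| * M * (K * h * |u|) ^ (m + 1) :=
              le_mul_of_one_le_right (by positivity) (one_le_pow₀ hKu)
          _ = _ := by rw [mul_pow, mul_pow]; ring
      have h5 := mul_le_mul_of_nonneg_right h3 (hT0 u)
      have h6 := mul_le_mul_of_nonneg_left h2 (abs_nonneg (w lam u))
      rw [mul_add] at h6
      linarith
  have i1 := (integrable_abs_w_mul_pow hlam (m + 1)).const_mul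
    (C * h ^ (m + 1) + M * K ^ (m + 1) * h ^ (m + 1))
  have i2 := (integrable_abs_w_mul_rpow hlam hβ).const_mul (B * (A * x₀ ^ β) * h ^ β)
  have i3 := hTi.const_mul (W * K ^ (m + 2) * h ^ (m + 2))
  have h7 := norm_integral_le_of_norm_le ((i1.add i2).add i3) (Eventually.of_forall hpt)
  rw [Real.norm_eq_abs] at h7
  refine h7.trans ?_
  rw [integral_add' (i1.add i2) i3, integral_add' i1 i2, integral_const_mul, integral_const_mul,
    integral_const_mul]
  have h8 : W * K ^ (m + 2) * h ^ (m + 2) * ∫ u, T u ≤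
      W * K ^ (m + 2) * (2 ^ (m + 1) * x₀⁻¹) * h ^ (m + 1) := by
    calc _ ≤ W * K ^ (m + 2) * h ^ (m + 2) * (2 ^ (m + 1) * x₀⁻¹ * h⁻¹) := by gcongr
      _ = _ := by rw [pow_succ h (m + 1)]; field_simp
  linarith

/-! ### The risk of a sample mean -/

theorem memLp_mean_sub {μ : Measure ℝ} [IsProbabilityMeasure μ] {ψ : ℝ → ℝ}
    (hψ : Measurable ψ) {S : ℝ} (hS : ∀ y, |ψ y| ≤ S) (n : ℕ) (a : ℝ) :
    MemLp (fun Y : Fin n → ℝ => (1 / n : ℝ) * ∑ j, ψ (Y j) - a) 2 (Measure.pi fun _ => μ) := by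
  have h : MemLp (fun Y : Fin n → ℝ => ∑ j, ψ (Y j)) 2 (Measure.pi fun _ => μ) :=
    memLp_finsetSum _ fun j _ =>
      MemLp.of_bound (hψ.comp (measurable_pi_apply j)).aestronglyMeasurable S
        (Eventually.of_forall fun Y => hS _)
  exact (h.const_mul _).sub (memLp_const a)

open ProbabilityTheory in
theorem integral_sq_mean_sub_le {μ : Measure ℝ} [IsProbabilityMeasure μ] {ψ : ℝ → ℝ}
    (hψ : Measurable ψ) {S : ℝ} (hS : ∀ y, |ψ y| ≤ S) {n : ℕ} (hn : 0 < n) (a : ℝ) :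
    ∫ Y : Fin n → ℝ, ((1 / n : ℝ) * ∑ j, ψ (Y j) - a) ^ 2 ∂(Measure.pi fun _ => μ) ≤
      S ^ 2 / n + ((∫ y, ψ y ∂μ) - a) ^ 2 := by
  set P := Measure.pi fun _ : Fin n => μ
  have hn0 : (n : ℝ) ≠ 0 := by positivity
  have hL : MemLp ψ 2 μ := MemLp.of_bound hψ.aestronglyMeasurable S (Eventually.of_forall hS)
  have hLj : ∀ j : Fin n, MemLp (fun Y : Fin n → ℝ => ψ (Y j)) 2 P := fun j =>
    MemLp.of_bound (hψ.comp (measurable_pi_apply j)).aestronglyMeasurable S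
      (Eventually.of_forall fun Y => hS _)
  have hLs : MemLp (fun Y : Fin n → ℝ => ∑ j, ψ (Y j)) 2 P := memLp_finsetSum _ fun j _ => hLj j
  have hmean : P[fun Y => (1 / n : ℝ) * ∑ j, ψ (Y j) - a] = (∫ y, ψ y ∂μ) - a := by
    have hi : ∀ j : Fin n, ∫ Y, ψ (Y j) ∂P = ∫ y, ψ y ∂μ := fun j => by
      rw [← (measurePreserving_eval (fun _ : Fin n => μ) j).map_eq,
        integral_map (measurable_pi_apply j).aemeasurable hψ.aestronglyMeasurable]
    rw [integral_sub ((hLs.integrable (by norm_num)).const_mul _) (integrable_const a),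
      integral_const_mul, integral_finsetSum _ fun j _ => (hLj j).integrable (by norm_num)]
    simp only [hi, integral_const, probReal_univ, one_smul, Finset.sum_const, Finset.card_univ,
      Fintype.card_fin, nsmul_eq_mul]
    field_simp
  have hvar : Var[fun Y : Fin n → ℝ => (1 / n : ℝ) * ∑ j, ψ (Y j) - a; P] ≤ S ^ 2 / n := by
    rw [variance_sub_const (hLs.aestronglyMeasurable.const_mul _), variance_const_mul]
    have h1 : Var[fun Y : Fin n → ℝ => ∑ j, ψ (Y j); P] = n * Var[ψ; μ] := by
      have := variance_sum_pi (μ := fun _ : Fin n => μ) (X := fun _ => ψ) fun _ => hL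
      rw [Finset.sum_const, Finset.card_univ, Fintype.card_fin, nsmul_eq_mul] at this
      rw [← this]
      congr 1
      funext Y
      simp
    have h2 : Var[ψ; μ] ≤ S ^ 2 := by
      refine (variance_le_expectation_sq hψ.aestronglyMeasurable).trans ?_
      have : ∫ y, (ψ ^ 2) y ∂μ ≤ ∫ _, S ^ 2 ∂μ := by
        refine integral_mono hL.integrable_sq (integrable_const _) fun y => ?_
        simp only [Pi.pow_apply]
        rw [← sq_abs]
        exact pow_le_pow_left₀ (abs_nonneg _) (hS y) 2
      simpa using this
    rw [h1]
    calc (1 / n : ℝ) ^ 2 * (n * Var[ψ; μ]) = Var[ψ; μ] / n := by field_simp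
      _ ≤ _ := by gcongr
  have := variance_eq_sub (memLp_mean_sub hψ hS n a (μ := μ))
  rw [hmean] at this
  simp only [Pi.pow_apply] at this
  linarith

/-- The target is real, so the imaginary part is compared with 0; each of the two parts contributes
S²/n, hence the factor 2. -/
theorem lintegral_enorm_mean_sub_le {μ : Measure ℝ} [IsProbabilityMeasure μ] {φ : ℝ → ℂ}
    (hφ : Measurable φ) {S : ℝ} (hS : ∀ y, ‖φ y‖ ≤ S) {n : ℕ} (hn : 0 < n) (a : ℝ) :
    ∫⁻ Y : Fin n → ℝ, ‖(1 / (n : ℂ)) * ∑ j, φ (Y j) - (a : ℂ)‖ₑ ^ (2 : ℝ)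
        ∂(Measure.pi fun _ => μ) ≤
      ENNReal.ofReal (2 * (S ^ 2 / n) + ‖(∫ y, φ y ∂μ) - a‖ ^ 2) := by
  set P := Measure.pi fun _ : Fin n => μ
  have hre : Measurable fun y => (φ y).re := Complex.measurable_re.comp hφ
  have him : Measurable fun y => (φ y).im := Complex.measurable_im.comp hφ
  have hSre : ∀ y, |(φ y).re| ≤ S := fun y => (Complex.abs_re_le_norm _).trans (hS y)
  have hSim : ∀ y, |(φ y).im| ≤ S := fun y => (Complex.abs_im_le_norm _).trans (hS y)
  have hi : Integrable φ μ := Integrable.of_bound hφ.aestronglyMeasurable S (Eventually.of_forall hS)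
  have bre := (memLp_mean_sub hre hSre n a (μ := μ)).integrable_sq
  have bim := (memLp_mean_sub him hSim n 0 (μ := μ)).integrable_sq
  have e1 : (1 / (n : ℂ)) = ((1 / n : ℝ) : ℂ) := by push_cast; rfl
  have key : ∀ Y : Fin n → ℝ, ‖(1 / (n : ℂ)) * ∑ j, φ (Y j) - (a : ℂ)‖ₑ ^ (2 : ℝ) =
      ENNReal.ofReal (((1 / n : ℝ) * ∑ j, (φ (Y j)).re - a) ^ 2
        + ((1 / n : ℝ) * ∑ j, (φ (Y j)).im - 0) ^ 2) := fun Y => by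
    rw [← ofReal_norm, ENNReal.ofReal_rpow_of_nonneg (norm_nonneg _) (by norm_num),
      Real.rpow_two, Complex.sq_norm, Complex.normSq_apply, e1]
    congr 1
    simp only [Complex.sub_re, Complex.sub_im, Complex.re_ofReal_mul, Complex.im_ofReal_mul,
      Complex.ofReal_re, Complex.ofReal_im, Complex.re_sum, Complex.im_sum]
    ring
  simp only [key]
  rw [← ofReal_integral_eq_lintegral_ofReal (f := fun Y : Fin n → ℝ =>
      ((1 / n : ℝ) * ∑ j, (φ (Y j)).re - a) ^ 2 + ((1 / n : ℝ) * ∑ j, (φ (Y j)).im - 0) ^ 2)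
    (bre.add bim)
    (Eventually.of_forall fun Y => add_nonneg (sq_nonneg _) (sq_nonneg _))]
  refine ENNReal.ofReal_le_ofReal ?_
  rw [integral_add bre bim]
  have h1 := integral_sq_mean_sub_le hre hSre (μ := μ) hn a
  have h2 := integral_sq_mean_sub_le him hSim (μ := μ) hn 0
  have h3 : ‖(∫ y, φ y ∂μ) - a‖ ^ 2 =
      ((∫ y, (φ y).re ∂μ) - a) ^ 2 + ((∫ y, (φ y).im ∂μ) - 0) ^ 2 := by
    have r1 : ∫ y, (φ y).re ∂μ = (∫ y, φ y ∂μ).re := integral_re hi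
    have r2 : ∫ y, (φ y).im ∂μ = (∫ y, φ y ∂μ).im := integral_im hi
    rw [Complex.sq_norm, Complex.normSq_apply, r1, r2]
    simp only [Complex.sub_re, Complex.sub_im, Complex.ofReal_re, Complex.ofReal_im]
    ring
  rw [h3]
  linarith

theorem maximalRisk_le {g : ℝ → ℝ} {x₀ : ℝ} {n : ℕ} {T : (Fin n → ℝ) → ℂ} {S : (ℝ → ℝ) → Prop}
    {R : ℝ} (hR : 0 ≤ R) (h : ∀ f, S f → ∫⁻ Y, ‖T Y - (f x₀ : ℂ)‖ₑ ^ (2 : ℝ)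
      ∂(Measure.pi fun _ : Fin n => lawY f g) ≤ ENNReal.ofReal (R ^ 2)) :
    maximalRisk g x₀ n T S ≤ ENNReal.ofReal R := by
  refine iSup₂_le fun f hf => ?_
  refine (ENNReal.rpow_le_rpow (h f hf) (by norm_num)).trans_eq ?_
  rw [ENNReal.ofReal_rpow_of_nonneg (by positivity) (by norm_num), ← Real.sqrt_eq_rpow,
    Real.sqrt_sq hR]

theorem maximalRisk_estimator_le {lam : ℕ} (hlam : 1 ≤ lam) (m : ℕ) {g : ℝ → ℝ}
    (hg : IsDensityOnNonneg g) {γ : ℝ} (hs : SuperSmooth g 1 γ) {x₀ r A β h B V R : ℝ}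
    (hx₀ : 0 < x₀) (hh : 0 < h)
    (hi : Integrable (multiplier lam m g h)) (hV : ∫ ω, ‖multiplier lam m g h ω‖ ≤ V)
    (hB : ∀ f, HolderClass x₀ r A β f →
      |(∫ x in Set.Ioi 0, f x * smoothed lam m h x₀ x) - f x₀| ≤ B)
    {n : ℕ} (hn : 0 < n) (hR : 0 ≤ R)
    (hle : 2 * (((2 * Real.pi * x₀)⁻¹ * V) ^ 2 / n) + B ^ 2 ≤ R ^ 2) :
    maximalRisk g x₀ n (estimator (kernelK lam m) g 0 h x₀ n) (HolderClass x₀ r A β) ≤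
      ENNReal.ofReal R := by
  obtain ⟨D, k, -, hmel⟩ := hs.inv_norm_mellin_le
  refine maximalRisk_le hR fun f hf => ?_
  have := isProbabilityMeasure_lawY hf.density hg
  have hb : ∀ y, ‖kernelL (kernelK lam m) g 0 h x₀ y‖ ≤ (2 * Real.pi * x₀)⁻¹ * V := fun y =>
    (norm_kernelL_le hlam m g h hx₀ y).trans (by gcongr)
  refine (lintegral_enorm_mean_sub_le (measurable_kernelL hlam m hg.measurable h hx₀) hb hn
    (f x₀)).trans (ENNReal.ofReal_le_ofReal (le_trans ?_ hle))
  rw [integral_kernelL_lawY hlam m hf.density hg hh hi (fun ω => (hmel ω).1) hx₀,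
    ← Complex.ofReal_sub, Complex.norm_real, Real.norm_eq_abs]
  have := hB f hf
  gcongr

/-! ### Asymptotics of the bandwidth -/

theorem tendsto_log_mul_natCast {E : ℝ} (hE : 0 < E) :
    Tendsto (fun n : ℕ => Real.log (E * n)) atTop atTop :=
  Real.tendsto_log_atTop.comp (tendsto_natCast_atTop_atTop.const_mul_atTop hE)

/-- The rate is stated in ln n and the bandwidth in L = ln(En); for large n the factor 2 absorbs |ln
E|. -/
theorem eventually_log_mul_natCast {E : ℝ} (hE : 0 < E) :
    ∀ᶠ n : ℕ in atTop, 0 < n ∧ 0 < Real.log n ∧ Real.log n ≤ 2 * Real.log (E * n) := by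
  have h := Real.tendsto_log_atTop.comp (tendsto_natCast_atTop_atTop (R := ℝ))
  filter_upwards [h.eventually_ge_atTop (2 * |Real.log E| + 1), eventually_gt_atTop 0] with n h1 hn
  have h1 : 2 * |Real.log E| + 1 ≤ Real.log n := h1
  have hn0 : (n : ℝ) ≠ 0 := by positivity
  rw [Real.log_mul hE.ne' hn0]
  have h2 := neg_abs_le (Real.log E)
  have h3 := abs_nonneg (Real.log E)
  refine ⟨hn, ?_, ?_⟩ <;> linarith

/-- The exponents 1 - 1/(2λ) and 2λ/(2λ-1) are reciprocal, so the left side is 2C₁^(-q)L. As q ≥ 1,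
C₁^(-q) ≤ 1/C₁ ≤ 1/8, uniformly in λ. -/
theorem two_mul_rpow_bandwidth_le {lam : ℕ} (hlam : 2 ≤ lam) {C₁ γ L : ℝ} (hC₁ : 8 ≤ C₁)
    (hγ : 0 < γ) (hL : 0 < L) :
    2 * (γ / (C₁ * γ * L ^ (-1 + 1 / (2 * (lam : ℝ))))) ^ ((2 * lam : ℝ) / (2 * lam - 1)) ≤
      L / 4 := by
  have hl : (2 : ℝ) ≤ lam := by exact_mod_cast hlam
  have hC0 : 0 < C₁ := by linarith
  set q : ℝ := (2 * lam : ℝ) / (2 * lam - 1) with hq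
  have hq1 : 1 ≤ q := by
    rw [hq, le_div_iff₀ (by linarith)]
    linarith
  have e : γ / (C₁ * γ * L ^ (-1 + 1 / (2 * (lam : ℝ)))) = C₁⁻¹ * L ^ (1 - 1 / (2 * (lam : ℝ))) := by
    rw [show -1 + 1 / (2 * (lam : ℝ)) = -(1 - 1 / (2 * (lam : ℝ))) by ring, Real.rpow_neg hL.le]
    field_simp
  have e2 : (1 - 1 / (2 * (lam : ℝ))) * q = 1 := by
    have : (2 * lam - 1 : ℝ) ≠ 0 := by linarith
    rw [hq]
    field_simp
  rw [e, Real.mul_rpow (by positivity) (by positivity), ← Real.rpow_mul hL.le, e2, Real.rpow_one]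
  have h1 : C₁⁻¹ ^ q ≤ C₁⁻¹ ^ (1 : ℝ) :=
    Real.rpow_le_rpow_of_exponent_ge (by positivity) (inv_le_one_of_one_le₀ (by linarith)) hq1
  have h2 : C₁⁻¹ ≤ 8⁻¹ := inv_anti₀ (by norm_num) hC₁
  rw [Real.rpow_one] at h1
  nlinarith

theorem tendsto_bandwidth {lam : ℕ} (hlam : 2 ≤ lam) (a : ℝ) :
    Tendsto (fun L : ℝ => a * L ^ (-1 + 1 / (2 * (lam : ℝ)))) atTop (nhds 0) := by
  have hl : (2 : ℝ) ≤ lam := by exact_mod_cast hlam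
  have hκ : 0 < 1 - 1 / (2 * (lam : ℝ)) := by
    rw [sub_pos, div_lt_one (by linarith)]
    linarith
  have := (tendsto_rpow_neg_atTop hκ).const_mul a
  rw [mul_zero] at this
  refine this.congr fun L => ?_
  rw [show -1 + 1 / (2 * (lam : ℝ)) = -(1 - 1 / (2 * (lam : ℝ))) by ring]

theorem eventually_bias_remainder_le {lam : ℕ} (hlam : 2 ≤ lam) {a β b C : ℝ} {m : ℕ} (ha : 0 < a)
    (hβ : β < m + 1) (hb : 0 < b) :
    ∀ᶠ L : ℝ in atTop, C * (a * L ^ (-1 + 1 / (2 * (lam : ℝ)))) ^ (m + 1) ≤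
      b * (a * L ^ (-1 + 1 / (2 * (lam : ℝ)))) ^ β := by
  have hp : 0 < (m : ℝ) + 1 - β := by linarith
  have h1 := ((tendsto_bandwidth hlam a).rpow_const (p := (m : ℝ) + 1 - β)
    (Or.inr hp.le)).const_mul C
  rw [Real.zero_rpow hp.ne', mul_zero] at h1
  filter_upwards [h1.eventually_le_const hb, eventually_gt_atTop 0] with L hL hL0
  set h := a * L ^ (-1 + 1 / (2 * (lam : ℝ)))
  have hh : 0 < h := by positivity
  calc C * h ^ (m + 1) = C * h ^ ((m : ℝ) + 1 - β) * h ^ β := by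
        rw [mul_assoc, ← Real.rpow_add hh, ← Real.rpow_natCast]
        congr 2
        push_cast
        ring
    _ ≤ b * h ^ β := by gcongr

/-- The crude bound 2/h ≤ (2/a)L suffices, since the exponential beats every power of L. The form
(2L)^(-s) is made for comparison with ln n ≤ 2L. -/
theorem eventually_variance_le {lam : ℕ} (hlam : 2 ≤ lam) {a b C s : ℝ} {k : ℕ} (ha : 0 < a)
    (hb : 0 < b) (hC : 0 ≤ C) :
    ∀ᶠ L : ℝ in atTop, C * (2 / (a * L ^ (-1 + 1 / (2 * (lam : ℝ))))
        + (2 / (a * L ^ (-1 + 1 / (2 * (lam : ℝ))))) ^ (k + 1)) ^ 2 * Real.exp (-(L / 2)) ≤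
      b * (2 * L) ^ (-s) := by
  have hl : (2 : ℝ) ≤ lam := by exact_mod_cast hlam
  set c : ℝ := 2 / a + (2 / a) ^ (k + 1) with hc
  have h1 := (tendsto_rpow_mul_exp_neg_mul_atTop_nhds_zero (2 * (k + 1) + s) (1 / 2)
    (by norm_num)).const_mul (C * c ^ 2 * 2 ^ s)
  rw [mul_zero] at h1
  filter_upwards [h1.eventually_le_const hb, eventually_ge_atTop 1] with L hL hL1
  have hL0 : 0 < L := by linarith
  have h2 : 2 / (a * L ^ (-1 + 1 / (2 * (lam : ℝ)))) ≤ 2 / a * L := by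
    rw [show -1 + 1 / (2 * (lam : ℝ)) = -(1 - 1 / (2 * (lam : ℝ))) by ring, Real.rpow_neg hL0.le]
    have : L ^ (1 - 1 / (2 * (lam : ℝ))) ≤ L ^ (1 : ℝ) :=
      Real.rpow_le_rpow_of_exponent_le hL1 (sub_le_self _ (by positivity))
    rw [Real.rpow_one] at this
    calc 2 / (a * (L ^ (1 - 1 / (2 * (lam : ℝ))))⁻¹) = 2 / a * L ^ (1 - 1 / (2 * (lam : ℝ))) := by
          field_simp
      _ ≤ _ := by gcongr
  have h3 : 2 / (a * L ^ (-1 + 1 / (2 * (lam : ℝ))))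
        + (2 / (a * L ^ (-1 + 1 / (2 * (lam : ℝ))))) ^ (k + 1) ≤ c * L ^ (k + 1) := by
    calc _ ≤ 2 / a * L + (2 / a * L) ^ (k + 1) := by gcongr
      _ ≤ 2 / a * L ^ (k + 1) + (2 / a) ^ (k + 1) * L ^ (k + 1) := by
          rw [mul_pow]
          gcongr
          exact le_self_pow₀ hL1 (by omega)
      _ = _ := by rw [hc]; ring
  calc _ ≤ C * (c * L ^ (k + 1)) ^ 2 * Real.exp (-(L / 2)) := by gcongr
    _ = C * c ^ 2 * 2 ^ s * (L ^ (2 * ((k : ℝ) + 1) + s) * Real.exp (-(1 / 2) * L))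
        * (2 * L) ^ (-s) := by
        have e1 : L ^ (2 * ((k : ℝ) + 1) + s) = (L ^ (k + 1)) ^ 2 * L ^ s := by
          rw [Real.rpow_add hL0, ← pow_mul, ← Real.rpow_natCast L]
          congr 2
          push_cast
          ring
        have e2 : (2 : ℝ) ^ s * L ^ s * (2 * L) ^ (-s) = 1 := by
          rw [← Real.mul_rpow (by norm_num) hL0.le, ← Real.rpow_add (by positivity)]
          simp
        rw [e1, show -(1 / 2) * L = -(L / 2) by ring]
        linear_combination (-(C * (c * L ^ (k + 1)) ^ 2 * Real.exp (-(L / 2)))) * e2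
    _ ≤ _ := by gcongr

theorem rpow_le_rate {lam : ℕ} (hlam : 2 ≤ lam) {C₁ γ β A x₀ L : ℝ} {n : ℕ} (hC₁ : 0 < C₁)
    (hγ : 0 < γ) (hβ : 0 < β) (hA : 0 < A) (hx₀ : 0 < x₀) (hn : 0 < Real.log n)
    (hL : Real.log n ≤ 2 * L) :
    A * x₀ ^ β * (C₁ * γ * L ^ (-1 + 1 / (2 * (lam : ℝ)))) ^ β ≤
      C₁ ^ β * 2 ^ (β * (1 - 1 / (2 * (lam : ℝ)))) * rate γ A x₀ β lam n := by
  have hl : (2 : ℝ) ≤ lam := by exact_mod_cast hlam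
  have hκ : 0 < 1 - 1 / (2 * (lam : ℝ)) := by
    rw [sub_pos, div_lt_one (by linarith)]
    linarith
  have hL0 : 0 < L := by linarith
  set κ := 1 - 1 / (2 * (lam : ℝ)) with hκd
  have h1 : (2 * L) ^ (-β * κ) ≤ Real.log n ^ (-β * κ) :=
    Real.rpow_le_rpow_of_nonpos hn hL (by nlinarith)
  have h2 : (L ^ (-1 + 1 / (2 * (lam : ℝ)))) ^ β = 2 ^ (β * κ) * (2 * L) ^ (-β * κ) := by
    rw [Real.mul_rpow (by norm_num) hL0.le, ← mul_assoc, ← Real.rpow_add (by norm_num),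
      ← Real.rpow_mul hL0.le]
    simp only [neg_mul, add_neg_cancel, Real.rpow_zero, one_mul]
    congr 1
    rw [hκd]
    ring
  rw [Real.mul_rpow (by positivity) (by positivity), Real.mul_rpow hC₁.le hγ.le, h2, rate]
  calc _ = C₁ ^ β * 2 ^ (β * κ) * (A * γ ^ β * (2 * L) ^ (-β * κ) * x₀ ^ β) := by ring
    _ ≤ _ := by gcongr

theorem le_rate_sq {lam : ℕ} (hlam : 2 ≤ lam) {γ β A x₀ L : ℝ} {n : ℕ}
    (hγ : 0 < γ) (hβ : 0 < β) (hA : 0 < A) (hx₀ : 0 < x₀) (hn : 0 < Real.log n)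
    (hL : Real.log n ≤ 2 * L) :
    (A * γ ^ β * x₀ ^ β) ^ 2 * (2 * L) ^ (-(2 * (β * (1 - 1 / (2 * (lam : ℝ)))))) ≤
      rate γ A x₀ β lam n ^ 2 := by
  have hl : (2 : ℝ) ≤ lam := by exact_mod_cast hlam
  have hκ : 0 < 1 - 1 / (2 * (lam : ℝ)) := by
    rw [sub_pos, div_lt_one (by linarith)]
    linarith
  have hL0 : 0 < L := by linarith
  set κ := 1 - 1 / (2 * (lam : ℝ)) with hκd
  have h1 : (2 * L) ^ (-β * κ) ≤ Real.log n ^ (-β * κ) :=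
    Real.rpow_le_rpow_of_nonpos hn hL (by nlinarith)
  have h2 : (2 * L) ^ (-(2 * (β * κ))) = ((2 * L) ^ (-β * κ)) ^ 2 := by
    rw [← Real.rpow_natCast, ← Real.rpow_mul (by positivity)]
    congr 1
    push_cast
    ring
  rw [h2, ← mul_pow]
  refine pow_le_pow_left₀ (by positivity) ?_ 2
  rw [rate]
  calc _ = A * γ ^ β * (2 * L) ^ (-β * κ) * x₀ ^ β := by ring
    _ ≤ _ := by gcongr

/-! ### Combining bias and variance -/

theorem eventually_maximalRisk_le {lam : ℕ} (hlam : 2 ≤ lam) {C₁ β : ℝ} (hC₁ : 8 ≤ C₁) (hβ : 0 < β)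
    {m : ℕ} (hm : β < m + 1) {C C' γ x₀ r A : ℝ} (hC : 0 ≤ C) {g : ℝ → ℝ}
    (hg : IsDensityOnNonneg g) (hs : SuperSmooth g 1 γ) (hx₀ : 0 < x₀) (hA : 0 < A)
    (hbias : ∀ f : ℝ → ℝ, HolderClass x₀ r A β f → ∀ h : ℝ, 0 < h →
      |(∫ x in Set.Ioi 0, f x * smoothed lam m h x₀ x) - f x₀| ≤
        C * (A * x₀ ^ β) * h ^ β + C' * h ^ (m + 1)) :
    ∀ᶠ n : ℕ in atTop, maximalRisk g x₀ n
        (estimator (kernelK lam m) g 0 (bandwidth C₁ γ A x₀ β lam n) x₀ n) (HolderClass x₀ r A β) ≤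
      ENNReal.ofReal (((C + 1) * (C₁ ^ β * 2 ^ (β * (1 - 1 / (2 * (lam : ℝ))))) + 1)
        * rate γ A x₀ β lam n) ∧ 0 < rate γ A x₀ β lam n := by
  have hγ := hs.1
  have hC₁0 : 0 < C₁ := by linarith
  have hl1 : 1 ≤ lam := by omega
  obtain ⟨V, k, hV, hmul⟩ := exists_multiplier_bound hl1 m hg.measurable hs
  set E := A ^ 2 * x₀ ^ (2 * β + 2) with hE
  have hE0 : 0 < E := by positivity
  have ht := tendsto_log_mul_natCast hE0
  have hvar := eventually_variance_le hlam (a := C₁ * γ) (b := (A * γ ^ β * x₀ ^ β) ^ 2)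
    (C := 2 * ((2 * Real.pi * x₀)⁻¹ * V) ^ 2 * E) (s := 2 * (β * (1 - 1 / (2 * (lam : ℝ)))))
    (k := k) (by positivity) (by positivity) (by positivity)
  have hrem := eventually_bias_remainder_le hlam (a := C₁ * γ) (b := A * x₀ ^ β) (C := C')
    (by positivity) hm (by positivity)
  filter_upwards [eventually_log_mul_natCast hE0, ht.eventually hvar, ht.eventually hrem]
    with n ⟨hn, hlog, hL1⟩ hvar hrem
  set L := Real.log (E * n) with hL
  have hL0 : 0 < L := by linarith
  have hb : bandwidth C₁ γ A x₀ β lam n = C₁ * γ * L ^ (-1 + 1 / (2 * (lam : ℝ))) := rfl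
  rw [hb]
  set h := C₁ * γ * L ^ (-1 + 1 / (2 * (lam : ℝ))) with hh
  have hh0 : 0 < h := by positivity
  have hrate : 0 < rate γ A x₀ β lam n := by
    unfold rate
    positivity
  refine ⟨?_, hrate⟩
  set D := C₁ ^ β * 2 ^ (β * (1 - 1 / (2 * (lam : ℝ)))) with hD
  have hD0 : 0 ≤ D := by positivity
  have hpow := rpow_le_rate hlam hC₁0 hγ hβ hA hx₀ hlog hL1
  have hsq := le_rate_sq hlam hγ hβ hA hx₀ hlog hL1
  rw [← hh, ← hD] at hpow
  set ρ := rate γ A x₀ β lam n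
  -- The extra 1 in C + 1 pays for the remainder C'h^(m+1), by `hrem`.
  have hB : ∀ f, HolderClass x₀ r A β f →
      |(∫ x in Set.Ioi 0, f x * smoothed lam m h x₀ x) - f x₀| ≤ (C + 1) * D * ρ := fun f hf => by
    have h1 := hbias f hf h hh0
    have h2 := mul_le_mul_of_nonneg_left hpow (by linarith : 0 ≤ C + 1)
    linarith
  have hexp : Real.exp (2 * (γ / h) ^ ((2 * lam : ℝ) / (2 * lam - 1))) ≤ Real.exp (L / 4) :=
    Real.exp_le_exp.mpr (two_mul_rpow_bandwidth_le hlam hC₁ hγ hL0)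
  have hVle : ∫ ω, ‖multiplier lam m g h ω‖ ≤
      V * (2 / h + (2 / h) ^ (k + 1)) * Real.exp (L / 4) :=
    (hmul h hh0).2.trans (by gcongr)
  have hexpL : Real.exp L = E * n := Real.exp_log (by positivity)
  have hvarle : 2 * (((2 * Real.pi * x₀)⁻¹ *
      (V * (2 / h + (2 / h) ^ (k + 1)) * Real.exp (L / 4))) ^ 2 / n) ≤ ρ ^ 2 := by
    refine le_trans (le_of_eq ?_) (hvar.trans hsq)
    -- Since e^L = En, this factorisation cancels the n in the denominator and leaves the decaying
    -- e^(-L/2).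
    have e1 : Real.exp (L / 4) ^ 2 = Real.exp L * Real.exp (-(L / 2)) := by
      rw [← Real.exp_nat_mul, ← Real.exp_add]
      congr 1
      push_cast
      ring
    rw [mul_pow _ (_ * Real.exp (L / 4)), mul_pow _ (Real.exp (L / 4)), e1, hexpL]
    have : (n : ℝ) ≠ 0 := by positivity
    field_simp
  refine maximalRisk_estimator_le hl1 m hg hs hx₀ hh0 (hmul h hh0).1 hVle hB hn (by positivity) ?_
  have h1 : 0 ≤ (C + 1) * D * ρ * ρ := by positivity
  nlinarith

end MultDeconv

theorem mainTheorem4 (lam : ℕ) (hlam : 2 ≤ lam) :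
    ∃ c : ℝ, 0 < c ∧ ∀ C₁ : ℝ, c ≤ C₁ → ∀ β : ℝ, 0 < β →
      ∀ m : ℕ, MultDeconv.strictFloor β + 1 ≤ m →
        ∃ C₂ : ℝ, 0 < C₂ ∧
          ∀ (g : ℝ → ℝ) (γ x₀ r A : ℝ), MultDeconv.IsDensityOnNonneg g →
            MultDeconv.SuperSmooth g 1 γ → 0 < x₀ → 1 < r → 0 < A →
            (∀ h : ℝ, 0 < h → ∀ y : ℝ, 0 < y →
              Integrable fun ω : ℝ =>
                MultDeconv.kernelLIntegrand (MultDeconv.kernelK lam m) g 0 h x₀ y ω) ∧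
            limsup (fun n : ℕ =>
                MultDeconv.maximalRisk g x₀ n
                    (MultDeconv.estimator (MultDeconv.kernelK lam m) g 0
                      (MultDeconv.bandwidth C₁ γ A x₀ β lam n) x₀ n)
                    (MultDeconv.HolderClass x₀ r A β)
                  / ENNReal.ofReal (MultDeconv.rate γ A x₀ β lam n)) atTop
              ≤ ENNReal.ofReal C₂ := by
  -- The threshold of `two_mul_rpow_bandwidth_le`, valid for every λ.
  refine ⟨8, by norm_num, fun C₁ hC₁ β hβ m hm => ?_⟩
  have hl1 : 1 ≤ lam := by omega
  have hC₁0 : 0 < C₁ := by linarith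
  obtain ⟨C, hC, hbias⟩ := MultDeconv.exists_bias_bound hl1 hβ m
  -- The product bounds the bias in units of the rate, with a power of 2 from ln n ≤ 2L; the final 1
  -- covers the standard deviation.
  refine ⟨(C + 1) * (C₁ ^ β * 2 ^ (β * (1 - 1 / (2 * (lam : ℝ))))) + 1, by positivity,
    fun g γ x₀ r A hg hs hx₀ hr hA => ⟨fun h hh y hy => ?_, ?_⟩⟩
  · obtain ⟨V, k, -, hmul⟩ := MultDeconv.exists_multiplier_bound hl1 m hg.measurable hs
    simp only [MultDeconv.kernelLIntegrand_eq hl1 m g h hx₀ hy]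
    exact MultDeconv.integrable_exp_mul_multiplier (hmul h hh).1 _
  · have hβm : β < m + 1 := by
      have h1 : β ≤ ⌈β⌉₊ := Nat.le_ceil β
      have h2 : ⌈β⌉₊ ≤ m := by
        unfold MultDeconv.strictFloor at hm
        omega
      have h3 : (⌈β⌉₊ : ℝ) ≤ m := by exact_mod_cast h2
      linarith
    obtain ⟨C', -, hb⟩ := hbias x₀ r A hx₀ hr hA
    refine limsup_le_of_le (h := ?_)
    filter_upwards [MultDeconv.eventually_maximalRisk_le hlam hC₁ hβ hβm hC hg hs hx₀ hA hb]
      with n ⟨hn, hrate⟩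
    refine ENNReal.div_le_of_le_mul (hn.trans_eq ?_)
    rw [ENNReal.ofReal_mul (by positivity)]
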